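/- **Setting.** Let $\theta=(\theta_0,\theta_x,\theta_1,\theta_\infty)\in\mathbb C^4$ with $\theta_\infty\ne0$. Let $y$ be a holomorphic branch, on an open set $U\subset\mathbb C\setminus\{0,1\}$, of a solution of the sixth Painlevé equation PVI$(\theta)$ $$y''=\tfrac12\Big[\tfrac1y+\tfrac1{y-1}+\tfrac1{y-x}\Big]y'^2-\Big[\tfrac1x+\tfrac1{x-1}+\tfrac1{y-x}\Big]y'+\tfrac{y(y-1)(y-x)}{x^2(x-1)^2}\Big[\alpha+\tfrac{\beta x}{y^2}+\tfrac{\gamma(x-1)}{(y-1)^2}+\tfrac{\delta x(x-1)}{(y-x)^2}\Big],$$ $\alpha=\frac12(\theta_\infty-1)^2$, $\beta=-\frac12\theta_0^2$, $\gamma=\frac12\theta_1^2$, $\delta=\frac12-\frac12\theta_x^2$, with $y(x)\notin\{0,1,x\}$ on $U$. Let $k$ be a nowhere vanishing function on $U$ with $\frac{d}{dx}\ln k=(\theta_\infty-1)\frac{y-x}{x(x-1)}$. The associated Fuchsian system at $x\in U$ is $$\frac{d\Psi}{d\lambda}=\Big[\frac{A_0}{\lambda}+\frac{A_x}{\lambda-x}+\frac{A_1}{\lambda-1}\Big]\Psi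 ,\qquad (\ast)$$ where, for $i=0,x,1$, $(A_i)_{11}=-(A_i)_{22}=z_i+\frac{\theta_i}2$, $$(A_0)_{12}=-\tfrac{ky}{x},\quad (A_x)_{12}=-\tfrac{k(y-x)}{x(x-1)},\quad (A_1)_{12}=\tfrac{k(y-1)}{x-1},$$ $$(A_0)_{21}=\tfrac{z_0x}{ky}(z_0+\theta_0),\quad (A_x)_{21}=\tfrac{x(x-1)z_x}{k(y-x)}(z_x+\theta_x),\quad (A_1)_{21}=-\tfrac{(x-1)z_1}{k(y-1)}(z_1+\theta_1),$$ and, with $\kappa_2=-\frac12(\theta_0+\theta_x+\theta_1+\theta_\infty)$, $\tilde z=\frac12\frac{x(x-1)}{y(y-1)(y-x)}\frac{dy}{dx}-\frac12\big\{\frac1{y-x}+\frac{\theta_0}{y}+\frac{\theta_x}{y-x}+\frac{\theta_1}{y-1}\big\}$, $$z_0=\tfrac{y}{x\theta_\infty}\big\{y(y-1)(y-x)\tilde z^2+[\theta_1(y-x)+x\theta_x(y-1)-2\kappa_2(y-1)(y-x)]\tilde z+\kappa_2^2(y-x-1)-\kappa_2(\theta_1+x\theta_x)\big\},$$ $$z_1=-\tfrac{y-1}{(x-1)\theta_\infty}\big\{y(y-1)(y-x)\tilde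 z^2+[(\theta_1+\theta_\infty)(y-x)+x\theta_x(y-1)-2\kappa_2(y-1)(y-x)]\tilde z+\kappa_2^2(y-x)-\kappa_2(\theta_1+x\theta_x)-\kappa_2(\kappa_2+\theta_\infty)\big\},$$ $$z_x=\tfrac{y-x}{x(x-1)\theta_\infty}\big\{y(y-1)(y-x)\tilde z^2+[\theta_1(y-x)+x(\theta_x+\theta_\infty)(y-1)-2\kappa_2(y-1)(y-x)]\tilde z+\kappa_2^2(y-1)-\kappa_2(\theta_1+x\theta_x)-x\kappa_2(\kappa_2+\theta_\infty)\big\}.$$ An *ordered basis of loops* in $\mathbb C\setminus\{0,x,1\}$ at a base point $b$ is a triple $\gamma_0,\gamma_x,\gamma_1$ of loops at $b$ generating the fundamental group, such that $\gamma_j$ is homotopic to a path from $b$ to a small circle centred at the pole $j$, followed by the circle once counter-clockwise and by the path backwards, and $\gamma_0\gamma_x\gamma_1$ (first $\gamma_0$, last $\gamma_1$) is homotopic to a loop of the same kind around a circle enclosing $0,x,1$. The monodromy matrix $M_\gamma$ of a fundamental matrix solution $\Psi$ near $b$ is defined by: analytic continuation of $\Psi$ along $\gamma$ is $\Psi M_\gamma$.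 Fix $x\in U$, such a basis, a fundamental solution $\Psi$ of $(\ast)$ near $b$, and let $M_0,M_x,M_1$ be its monodromy matrices along $\gamma_0,\gamma_x,\gamma_1$. **Symmetry $\sigma^3$**: $\theta'=(\theta_0',\theta_x',\theta_1',\theta_\infty')=(\theta_0,\theta_1,\theta_x,\theta_\infty)$, $x'=1/x$, $y'(x')=y(x)/x$. The function $y'$ solves PVI$(\theta')$. Let $k'$ be any function which is to $y',\theta'$ as $k$ is to $y,\theta$, and let $A'_0,A'_{x'},A'_1$ be the residues of the system associated with $\theta',y',k'$ at $x'$. Put $K=\mathrm{diag}\big(\frac{k}{xk'},1\big)$. Then: 1. $\frac{d}{dx}\ln\frac{k'(1/x)}{k(x)}=\frac{\theta_\infty-1}{x}$ on $U$ (so $k'=\mathrm{const}\cdot k\,x^{\theta_\infty-1}$ locally); $A_0'=K^{-1}A_0K$, $A'_{x'}=K^{-1}A_1K$, $A_1'=K^{-1}A_xK$; $\Phi(\lambda)$ is a fundamental solution of $(\ast)$ near a point $\lambda\notin\{0,x,1\}$ if and only if $\Phi'(\lambda')=K^{-1}\Phi(x\lambda')$ is one of the primed system near $\lambda/x$; and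 for $\lambda'\notin\{0,x',1\}$ the $(1,2)$ entry of $\frac{A_0}{\lambda'}+\frac{A_1}{\lambda'-x'}+\frac{A_x}{\lambda'-1}$ vanishes if and only if $\lambda'=y'(x')$. 2. Let $\tilde\gamma_0,\tilde\gamma_1,\tilde\gamma_{x'}$ be the images of $\gamma_0,\gamma_x,\gamma_1$ under $\lambda'=\lambda/x$. Any loops $\gamma'_0,\gamma'_{x'},\gamma'_1$ homotopic respectively to $\tilde\gamma_0$, $\tilde\gamma_1\tilde\gamma_{x'}\tilde\gamma_1^{-1}$, $\tilde\gamma_1$ form an ordered basis of loops in $\mathbb C\setminus\{0,x',1\}$, and the monodromy matrices of $\Psi'(\lambda')=K^{-1}\Psi(x\lambda')$ along them exist, are unique, and are $M_0'=M_0$, $M_{x'}'=M_x^{-1}M_1M_x$, $M_1'=M_x$. 3. $\mathrm{tr}(M_0'M_{x'}')=-\mathrm{tr}(M_0M_1)-\mathrm{tr}(M_0M_x)\,\mathrm{tr}(M_1M_x)+4\big(\cos\pi\theta_\infty\cos\pi\theta_x+\cos\pi\theta_0\cos\pi\theta_1\big)$, $\ \mathrm{tr}(M_0'M_1')=\mathrm{tr}(M_0M_x)$,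 $\ \mathrm{tr}(M_1'M_{x'}')=\mathrm{tr}(M_1M_x)$. **Symmetry $\sigma^1$**: $\theta'=(\theta_1,\theta_x,\theta_0,\theta_\infty)$, $x'=1-x$, $y'(x')=1-y(x)$. The function $y'$ solves PVI$(\theta')$. With $k'$ and $A'_j$ as before (now for this $\theta',y',x'$) and $K=\mathrm{diag}\big(-\frac{k}{k'},1\big)$: 1. $A_0'=K^{-1}A_1K$, $A'_{x'}=K^{-1}A_xK$, $A_1'=K^{-1}A_0K$; $\Phi(\lambda)$ is a fundamental solution of $(\ast)$ near $\lambda\notin\{0,x,1\}$ if and only if $\Phi'(\lambda')=K^{-1}\Phi(1-\lambda')$ is one of the primed system near $1-\lambda$; and for $\lambda'\notin\{0,x',1\}$ the $(1,2)$ entry of $\frac{A_1}{\lambda'}+\frac{A_x}{\lambda'-x'}+\frac{A_0}{\lambda'-1}$ vanishes if and only if $\lambda'=y'(x')$. 2. Let $\tilde\gamma_1,\tilde\gamma_{x'},\tilde\gamma_0$ be the images of $\gamma_0,\gamma_x,\gamma_1$ under $\lambda'=1-\lambda$. Any loops $\gamma'_0,\gamma'_{x'},\gamma'_1$ homotopic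 respectively to $\tilde\gamma_0$, $\tilde\gamma_0^{-1}\tilde\gamma_{x'}\tilde\gamma_0$, $\tilde\gamma_0^{-1}\tilde\gamma_{x'}^{-1}\tilde\gamma_1\tilde\gamma_{x'}\tilde\gamma_0$ form an ordered basis of loops in $\mathbb C\setminus\{0,x',1\}$, and the monodromy matrices of $\Psi'(\lambda')=K^{-1}\Psi(1-\lambda')$ along them exist, are unique, and are $M_0'=M_1$, $M_{x'}'=M_1M_xM_1^{-1}$, $M_1'=M_1M_xM_0M_x^{-1}M_1^{-1}$. 3. $\mathrm{tr}(M_0'M_{x'}')=\mathrm{tr}(M_1M_x)$, $\ \mathrm{tr}(M_0'M_1')=-\mathrm{tr}(M_0M_1)-\mathrm{tr}(M_1M_x)\,\mathrm{tr}(M_0M_x)+4\big(\cos\pi\theta_\infty\cos\pi\theta_x+\cos\pi\theta_1\cos\pi\theta_0\big)$, $\ \mathrm{tr}(M_1'M_{x'}')=\mathrm{tr}(M_0M_x)$. -/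

import Mathlib

open Topology Filter
open scoped unitInterval

noncomputable section

/-- The parameters `θ_0, θ_x, θ_1, θ_∞`. -/
structure Theta where
  t0 : ℂ
  tx : ℂ
  t1 : ℂ
  tinf : ℂ

/-- `y` is a branch, on the open set `U`, of a solution of the sixth Painlevé equation with
`α = (θ_∞ - 1)² / 2`, `β = - θ_0² / 2`, `γ = θ_1² / 2`, `δ = 1/2 - θ_x² / 2`. -/
def IsPVISolution (θ : Theta) (U : Set ℂ) (y : ℂ → ℂ) : Prop :=
  IsOpen U ∧ DifferentiableOn ℂ y U ∧ ∀ x ∈ U,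
    x ≠ 0 ∧ x ≠ 1 ∧ y x ≠ 0 ∧ y x ≠ 1 ∧ y x ≠ x ∧
    deriv (deriv y) x =
      1 / 2 * (1 / y x + 1 / (y x - 1) + 1 / (y x - x)) * deriv y x ^ 2
      - (1 / x + 1 / (x - 1) + 1 / (y x - x)) * deriv y x
      + y x * (y x - 1) * (y x - x) / (x ^ 2 * (x - 1) ^ 2) *
        ((θ.tinf - 1) ^ 2 / 2 + (-(θ.t0 ^ 2 / 2)) * x / y x ^ 2
          + θ.t1 ^ 2 / 2 * (x - 1) / (y x - 1) ^ 2
          + (1 / 2 - θ.tx ^ 2 / 2) * x * (x - 1) / (y x - x) ^ 2)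

/-- A function `k` on `U` without zeros with `d (ln k) / dx = (θ_∞ - 1) (y - x) / (x (x - 1))`. -/
def IsGaugeFactor (θ : Theta) (U : Set ℂ) (y k : ℂ → ℂ) : Prop :=
  ∀ x ∈ U, k x ≠ 0 ∧
    HasDerivAt k ((θ.tinf - 1) * (y x - x) / (x * (x - 1)) * k x) x

/-! ### Fuchsian systems with poles `0, x, 1, ∞` -/

/-- The residues of the system `dΨ/dλ = (A_0 / λ + A_x / (λ - x) + A_1 / (λ - 1)) Ψ`. -/
structure FuchsianSystem (x : ℂ) where
  A0 : Matrix (Fin 2) (Fin 2) ℂ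
  Ax : Matrix (Fin 2) (Fin 2) ℂ
  A1 : Matrix (Fin 2) (Fin 2) ℂ

namespace FuchsianSystem

variable {x : ℂ}

/-- The coefficient matrix `A(λ)`. -/
def coeff (S : FuchsianSystem x) (l : ℂ) : Matrix (Fin 2) (Fin 2) ℂ :=
  (1 / l) • S.A0 + (1 / (l - x)) • S.Ax + (1 / (l - 1)) • S.A1

/-- `Ψ` solves the system in a neighbourhood of `z`. -/
def IsSolutionNear (S : FuchsianSystem x) (Ψ : ℂ → Matrix (Fin 2) (Fin 2) ℂ) (z : ℂ) : Prop :=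
  ∀ᶠ w in 𝓝 z, ∀ i j, HasDerivAt (fun l => Ψ l i j) ((S.coeff w * Ψ w) i j) w

/-- `Ψ` is a fundamental matrix solution in a neighbourhood of `z`. -/
def IsFundamentalNear (S : FuchsianSystem x) (Ψ : ℂ → Matrix (Fin 2) (Fin 2) ℂ) (z : ℂ) : Prop :=
  S.IsSolutionNear Ψ z ∧ (Ψ z).det ≠ 0

end FuchsianSystem

/-- The system associated with the value `y` of the transcendent, the value `p` of its derivative
and the value `k` of the gauge factor at the point `x`. -/
def jmuSystem (θ : Theta) (x y p k : ℂ) : FuchsianSystem x :=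
  let κ₂ : ℂ := -(θ.t0 / 2 + θ.tx / 2 + θ.t1 / 2 + θ.tinf / 2)
  let zt : ℂ := 1 / 2 * (x * (x - 1) / (y * (y - 1) * (y - x))) * p
    - 1 / 2 * (1 / (y - x) + θ.t0 / y + θ.tx / (y - x) + θ.t1 / (y - 1))
  let z0 : ℂ := y / (x * θ.tinf) *
    (y * (y - 1) * (y - x) * zt ^ 2
      + (θ.t1 * (y - x) + x * θ.tx * (y - 1) - 2 * κ₂ * (y - 1) * (y - x)) * zt
      + κ₂ ^ 2 * (y - x - 1) - κ₂ * (θ.t1 + x * θ.tx))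
  let z1 : ℂ := -((y - 1) / ((x - 1) * θ.tinf)) *
    (y * (y - 1) * (y - x) * zt ^ 2
      + ((θ.t1 + θ.tinf) * (y - x) + x * θ.tx * (y - 1) - 2 * κ₂ * (y - 1) * (y - x)) * zt
      + κ₂ ^ 2 * (y - x) - κ₂ * (θ.t1 + x * θ.tx) - κ₂ * (κ₂ + θ.tinf))
  let zx : ℂ := (y - x) / (x * (x - 1) * θ.tinf) *
    (y * (y - 1) * (y - x) * zt ^ 2
      + (θ.t1 * (y - x) + x * (θ.tx + θ.tinf) * (y - 1) - 2 * κ₂ * (y - 1) * (y - x)) * zt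
      + κ₂ ^ 2 * (y - 1) - κ₂ * (θ.t1 + x * θ.tx) - x * κ₂ * (κ₂ + θ.tinf))
  { A0 := !![z0 + θ.t0 / 2, -(k * y / x);
             z0 * x / (k * y) * (z0 + θ.t0), -(z0 + θ.t0 / 2)]
    Ax := !![zx + θ.tx / 2, -(k * (y - x) / (x * (x - 1)));
             x * (x - 1) * zx / (k * (y - x)) * (zx + θ.tx), -(zx + θ.tx / 2)]
    A1 := !![z1 + θ.t1 / 2, k * (y - 1) / (x - 1);
             -((x - 1) * z1 / (k * (y - 1))) * (z1 + θ.t1), -(z1 + θ.t1 / 2)] }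

/-- The system associated with the transcendent `y` (and the gauge factor `k`) at the point `x`. -/
def assocSystem (θ : Theta) (y k : ℂ → ℂ) (x : ℂ) : FuchsianSystem x :=
  jmuSystem θ x (y x) (deriv y x) (k x)

/-! ### Loops in the punctured plane and monodromy -/

/-- `ℂ ∖ {0, x, 1}`. -/
abbrev PuncturedPlane (x : ℂ) : Type :=
  {l : ℂ // l ≠ 0 ∧ l ≠ x ∧ l ≠ 1}

/-- Up to homotopy, `γ` follows a path `δ`, then the circle `t ↦ a + r exp(2πit)` once, then `δ`
backwards. -/
def IsConjCircle {x : ℂ} {b : PuncturedPlane x} (a r : ℂ) (γ : Path b b) : Prop :=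
  ∃ (c : PuncturedPlane x) (δ : Path b c) (ω : Path c c),
    (∀ t : I, (ω t : ℂ) = a + r * Complex.exp (2 * Real.pi * Complex.I * ((t : ℝ) : ℂ))) ∧
    γ.Homotopic (δ.trans (ω.trans δ.symm))

/-- `γ` goes once, counter-clockwise, around the single pole `a`. -/
def IsLoopAround {x : ℂ} {b : PuncturedPlane x} (a : ℂ) (γ : Path b b) : Prop :=
  ∃ r : ℂ, r ≠ 0 ∧ (∀ p ∈ ({0, x, 1} : Set ℂ), p ≠ a → ‖r‖ < ‖p - a‖) ∧ IsConjCircle a r γ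

/-- `γ` goes once, counter-clockwise, around all the poles `0, x, 1`. -/
def IsLoopAroundAll {x : ℂ} {b : PuncturedPlane x} (γ : Path b b) : Prop :=
  ∃ a r : ℂ, (∀ p ∈ ({0, x, 1} : Set ℂ), ‖p - a‖ < ‖r‖) ∧ IsConjCircle a r γ

/-- `γ₀, γₓ, γ₁` is a basis of loops, ordered in the order `0, x, 1`: each is a positive simple
loop around its pole, they generate the fundamental group, and `γ₀ γₓ γ₁` (first `γ₀`, then `γₓ`,
then `γ₁`) is a positive loop around all three poles. -/
structure IsOrderedBasis {x : ℂ} {b : PuncturedPlane x} (g0 gx g1 : Path b b) : Prop where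
  around_zero : IsLoopAround 0 g0
  around_x : IsLoopAround x gx
  around_one : IsLoopAround 1 g1
  around_all : IsLoopAroundAll ((g0.trans gx).trans g1)
  generate : Subgroup.closure
    ({FundamentalGroup.fromPath (Path.Homotopic.Quotient.mk g0),
      FundamentalGroup.fromPath (Path.Homotopic.Quotient.mk gx),
      FundamentalGroup.fromPath (Path.Homotopic.Quotient.mk g1)} :
        Set (FundamentalGroup (PuncturedPlane x) b)) = ⊤

/-- Analytic continuation along the loop `γ` turns the germ at `b` of the solution `Ψ` into the
germ of `Ψ M`; the germ reached at time `t` is that of `F t`. -/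
def IsMonodromy {x : ℂ} (S : FuchsianSystem x) {b : PuncturedPlane x}
    (Ψ : ℂ → Matrix (Fin 2) (Fin 2) ℂ) (γ : Path b b) (M : Matrix (Fin 2) (Fin 2) ℂ) : Prop :=
  ∃ F : I → ℂ → Matrix (Fin 2) (Fin 2) ℂ,
    (F 0 =ᶠ[𝓝 (b : ℂ)] Ψ) ∧ (F 1 =ᶠ[𝓝 (b : ℂ)] fun l => Ψ l * M) ∧
    ∀ t : I, S.IsSolutionNear (F t) (γ t : ℂ) ∧
      ∀ᶠ s in 𝓝 t, F s =ᶠ[𝓝 (γ s : ℂ)] F t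

/-! ### The symmetry `σ³` : `x' = 1 / x`, `y'(x') = y(x) / x`, `λ' = λ / x` -/

def sigma3Theta (θ : Theta) : Theta := ⟨θ.t0, θ.t1, θ.tx, θ.tinf⟩

def sigma3Fun (y : ℂ → ℂ) : ℂ → ℂ := fun x' => 1 / x'⁻¹ * y x'⁻¹

def sigma3Gauge (x k k' : ℂ) : Matrix (Fin 2) (Fin 2) ℂ := !![k / (x * k'), 0; 0, 1]

/-- The map `λ ↦ λ / x` from `ℂ ∖ {0, x, 1}` to `ℂ ∖ {0, x⁻¹, 1}`. -/
def sigma3Map {x : ℂ} (hx : x ≠ 0) : C(PuncturedPlane x, PuncturedPlane x⁻¹) where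
  toFun l := ⟨l.1 / x, div_ne_zero l.2.1 hx,
    fun h => l.2.2.2 (by
      have h2 := congrArg (· * x) h
      simpa [hx] using h2),
    fun h => l.2.2.1 (by
      have h2 := congrArg (· * x) h
      simpa [hx] using h2)⟩
  continuous_toFun := by fun_prop

/-! ### The symmetry `σ¹` : `x' = 1 - x`, `y'(x') = 1 - y(x)`, `λ' = 1 - λ` -/

def sigma1Theta (θ : Theta) : Theta := ⟨θ.t1, θ.tx, θ.t0, θ.tinf⟩

def sigma1Fun (y : ℂ → ℂ) : ℂ → ℂ := fun x' => 1 - y (1 - x')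

def sigma1Gauge (k k' : ℂ) : Matrix (Fin 2) (Fin 2) ℂ := !![-(k / k'), 0; 0, 1]

/-- The map `λ ↦ 1 - λ` from `ℂ ∖ {0, x, 1}` to `ℂ ∖ {0, 1 - x, 1}`. -/
def sigma1Map (x : ℂ) : C(PuncturedPlane x, PuncturedPlane (1 - x)) where
  toFun l := ⟨1 - l.1, fun h => l.2.2.2 (sub_eq_zero.mp h).symm,
    fun h => l.2.2.1 (sub_right_injective h),
    fun h => l.2.1 (by simpa using h)⟩
  continuous_toFun := by fun_prop

end

noncomputable section

/-! ### The transformed solutions of the sixth Painlevé equation -/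

/-! Both symmetries come from an affine change of λ that permutes the poles, followed by a constant
diagonal gauge. That the Painlevé equation is preserved and that the residues of the new system are
the permuted, conjugated old ones are rational identities (`IsPVISolution.sigma3`,
`IsPVISolution.sigma1`, `jmuSystem_sigma3`, `jmuSystem_sigma1`). The variable z̃ is multiplied by x,
respectively by -1, and then `z_0, z_x, z_1` are only permuted.

An affine change carries solutions to solutions and continuations to continuations, so along the
image loops the monodromy matrices are unchanged (`IsMonodromy.map`). The image loops have the right
product but the wrong order of poles; a braid move restores the order
(`isOrderedBasis_of_conj_right`, `isOrderedBasis_of_conj_left`). Since monodromy reverses products,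
a conjugated loop such as t₁ tₓ t₁⁻¹ gets the matrix Mₓ⁻¹ M₁ Mₓ.

The one trace that is not obtained by cyclicity follows from an SL₂ identity
(`trace_mul_inv_mul_mul`), into which tr Mⱼ = 2 cos πθⱼ and tr(M₁ Mₓ M₀) = 2 cos πθ_∞ are
substituted. These values are found without local normal forms, so resonant exponents need no
separate treatment. The trace is invariant under free homotopy (`IsMonodromy.trace_eq_of_family`),
so the circle may shrink to its pole or grow to infinity. In the angle the equation then tends to
one with constant coefficient 2πi L, where L is the residue or the sum of residues, and Gronwall's
inequality shows that the trace is that of exp(2πi L) (`exists_norm_trace_sub_le`,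
`IsMonodromy.trace_circle`).

Underneath lies analytic continuation: solutions exist on discs of a uniform radius by Picard
iteration (`exists_hasDerivAt_linear`), hence continuation along every path exists
(`exists_continues_ball`) and depends only on its homotopy class (`IsContinuation.of_homotopic`). -/

lemma hasDerivAt_deriv_of_mem {U : Set ℂ} (hU : IsOpen U) {y : ℂ → ℂ}
    (hy : DifferentiableOn ℂ y U) {u : ℂ} (hu : u ∈ U) :
    HasDerivAt y (deriv y u) u ∧ HasDerivAt (deriv y) (deriv (deriv y) u) u :=
  ⟨(hy.differentiableAt (hU.mem_nhds hu)).hasDerivAt,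
    ((hy.deriv hU).differentiableAt (hU.mem_nhds hu)).hasDerivAt⟩

lemma isOpen_inv_preimage {U : Set ℂ} (hU : IsOpen U) (h0 : (0 : ℂ) ∉ U) :
    IsOpen {w : ℂ | w⁻¹ ∈ U} := by
  rw [isOpen_iff_mem_nhds]
  intro w hw
  have hw0 : w ≠ 0 := by
    rintro rfl
    exact h0 (by simpa using hw)
  exact (continuousAt_inv₀ hw0).preimage_mem_nhds (hU.mem_nhds hw)

lemma hasDerivAt_sigma3Fun {U : Set ℂ} (hU : IsOpen U) (h0 : (0 : ℂ) ∉ U) {y : ℂ → ℂ}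
    (hy : DifferentiableOn ℂ y U) {w : ℂ} (hw : w⁻¹ ∈ U) :
    HasDerivAt (sigma3Fun y) (y w⁻¹ - w⁻¹ * deriv y w⁻¹) w := by
  have hw0 : w ≠ 0 := by
    rintro rfl
    exact h0 (by simpa using hw)
  have h1 := (hasDerivAt_deriv_of_mem hU hy hw).1
  have h2 := (hasDerivAt_id w).mul (h1.comp w (hasDerivAt_inv hw0))
  have h3 : sigma3Fun y = fun v => v * y v⁻¹ := by
    funext v
    simp [sigma3Fun]
  rw [h3]
  refine h2.congr_deriv ?_
  simp only [id, Function.comp]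
  field_simp
  ring

lemma deriv_sigma3Fun {U : Set ℂ} (hU : IsOpen U) (h0 : (0 : ℂ) ∉ U) {y : ℂ → ℂ}
    (hy : DifferentiableOn ℂ y U) {w : ℂ} (hw : w⁻¹ ∈ U) :
    deriv (sigma3Fun y) w = y w⁻¹ - w⁻¹ * deriv y w⁻¹ :=
  (hasDerivAt_sigma3Fun hU h0 hy hw).deriv

lemma deriv_deriv_sigma3Fun {U : Set ℂ} (hU : IsOpen U) (h0 : (0 : ℂ) ∉ U) {y : ℂ → ℂ}
    (hy : DifferentiableOn ℂ y U) {w : ℂ} (hw : w⁻¹ ∈ U) :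
    deriv (deriv (sigma3Fun y)) w = w⁻¹ ^ 3 * deriv (deriv y) w⁻¹ := by
  have hw0 : w ≠ 0 := by
    rintro rfl
    exact h0 (by simpa using hw)
  have h : deriv (sigma3Fun y) =ᶠ[𝓝 w] fun v => y v⁻¹ - v⁻¹ * deriv y v⁻¹ := by
    filter_upwards [(isOpen_inv_preimage hU h0).mem_nhds hw] with v hv
      using deriv_sigma3Fun hU h0 hy hv
  obtain ⟨h1, h2⟩ := hasDerivAt_deriv_of_mem hU hy hw
  have hi := hasDerivAt_inv hw0
  have h3 := (h1.comp w hi).sub (hi.mul (h2.comp w hi))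
  have h4 : HasDerivAt (fun v => y v⁻¹ - v⁻¹ * deriv y v⁻¹) _ w := h3
  rw [h.deriv_eq, h4.deriv]
  simp only [Function.comp]
  field_simp
  ring

lemma hasDerivAt_sigma1Fun {U : Set ℂ} (hU : IsOpen U) {y : ℂ → ℂ}
    (hy : DifferentiableOn ℂ y U) {w : ℂ} (hw : 1 - w ∈ U) :
    HasDerivAt (sigma1Fun y) (deriv y (1 - w)) w := by
  have h := ((hasDerivAt_deriv_of_mem hU hy hw).1.comp w
    ((hasDerivAt_id w).const_sub 1)).const_sub 1
  exact h.congr_deriv (by simp)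

lemma deriv_sigma1Fun {U : Set ℂ} (hU : IsOpen U) {y : ℂ → ℂ}
    (hy : DifferentiableOn ℂ y U) {w : ℂ} (hw : 1 - w ∈ U) :
    deriv (sigma1Fun y) w = deriv y (1 - w) :=
  (hasDerivAt_sigma1Fun hU hy hw).deriv

lemma isOpen_one_sub_preimage {U : Set ℂ} (hU : IsOpen U) : IsOpen {w : ℂ | 1 - w ∈ U} :=
  hU.preimage (by fun_prop)

lemma deriv_deriv_sigma1Fun {U : Set ℂ} (hU : IsOpen U) {y : ℂ → ℂ}
    (hy : DifferentiableOn ℂ y U) {w : ℂ} (hw : 1 - w ∈ U) :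
    deriv (deriv (sigma1Fun y)) w = -deriv (deriv y) (1 - w) := by
  have h : deriv (sigma1Fun y) =ᶠ[𝓝 w] fun v => deriv y (1 - v) := by
    filter_upwards [(isOpen_one_sub_preimage hU).mem_nhds hw] with v hv
      using deriv_sigma1Fun hU hy hv
  have h3 := (hasDerivAt_deriv_of_mem hU hy hw).2.comp w ((hasDerivAt_id w).const_sub 1)
  have h4 : HasDerivAt (fun v => deriv y (1 - v)) _ w := h3
  rw [h.deriv_eq, h4.deriv]
  simp

/-- Division by x fixes 0 and exchanges 1 with x, so the terms with θ_x and θ_1 trade places; the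
asymmetric 1/2 in δ is absorbed by the terms in the first derivative. -/
lemma IsPVISolution.sigma3 {θ : Theta} {U : Set ℂ} {y : ℂ → ℂ} (hy : IsPVISolution θ U y) :
    IsPVISolution (sigma3Theta θ) {x' | x'⁻¹ ∈ U} (sigma3Fun y) := by
  obtain ⟨hU, hd, h⟩ := hy
  have h0 : (0 : ℂ) ∉ U := fun h0 => (h 0 h0).1 rfl
  refine ⟨isOpen_inv_preimage hU h0, fun w hw =>
    (hasDerivAt_sigma3Fun hU h0 hd hw).differentiableAt.differentiableWithinAt, fun w hw => ?_⟩
  rw [deriv_deriv_sigma3Fun hU h0 hd hw, deriv_sigma3Fun hU h0 hd hw]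
  obtain ⟨u, rfl⟩ : ∃ u : ℂ, w = u⁻¹ := ⟨w⁻¹, by simp⟩
  simp only [Set.mem_ofPred_eq, inv_inv] at hw
  obtain ⟨hu0, hu1, hy0, hy1, hyu, he⟩ := h u hw
  simp only [sigma3Fun, sigma3Theta, inv_inv]
  rw [he]
  generalize y u = v at *
  generalize deriv y u = p at *
  have e1 : v - 1 ≠ 0 := sub_ne_zero.mpr hy1
  have e2 : v - u ≠ 0 := sub_ne_zero.mpr hyu
  have e3 : u - 1 ≠ 0 := sub_ne_zero.mpr hu1
  have e4 : 1 - u ≠ 0 := sub_ne_zero.mpr (Ne.symm hu1)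
  refine ⟨inv_ne_zero hu0, ?_, mul_ne_zero (one_div_ne_zero hu0) hy0, ?_, ?_, ?_⟩
  · simpa using hu1
  · intro h
    exact hyu (by field_simp at h; exact h)
  · intro h
    exact hy1 (by field_simp at h; exact h)
  -- Every new difference is rewritten through the old ones, whose non-vanishing is known, so that
  -- all denominators can be cleared.
  · have f1 : 1 / u * v - 1 = (v - u) / u := by field_simp
    have f2 : 1 / u * v - u⁻¹ = (v - 1) / u := by field_simp
    have f3 : u⁻¹ - 1 = (1 - u) / u := by field_simp
    have f4 : 1 - u = -(u - 1) := by ring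
    rw [f1, f2, f3, f4]
    field_simp
    ring

lemma IsPVISolution.sigma1 {θ : Theta} {U : Set ℂ} {y : ℂ → ℂ} (hy : IsPVISolution θ U y) :
    IsPVISolution (sigma1Theta θ) {x' | 1 - x' ∈ U} (sigma1Fun y) := by
  obtain ⟨hU, hd, h⟩ := hy
  refine ⟨isOpen_one_sub_preimage hU, fun w hw =>
    (hasDerivAt_sigma1Fun hU hd hw).differentiableAt.differentiableWithinAt, fun w hw => ?_⟩
  rw [deriv_deriv_sigma1Fun hU hd hw, deriv_sigma1Fun hU hd hw]
  obtain ⟨u, rfl⟩ : ∃ u : ℂ, w = 1 - u := ⟨1 - w, by ring⟩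
  simp only [Set.mem_ofPred_eq, sub_sub_cancel] at hw
  obtain ⟨hu0, hu1, hy0, hy1, hyu, he⟩ := h u hw
  simp only [sigma1Fun, sigma1Theta, sub_sub_cancel]
  rw [he]
  generalize y u = v at *
  generalize deriv y u = p at *
  have e1 : v - 1 ≠ 0 := sub_ne_zero.mpr hy1
  have e2 : v - u ≠ 0 := sub_ne_zero.mpr hyu
  have e3 : u - 1 ≠ 0 := sub_ne_zero.mpr hu1
  refine ⟨sub_ne_zero.mpr (Ne.symm hu1), ?_, sub_ne_zero.mpr (Ne.symm hy1), ?_, ?_, ?_⟩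
  · simpa using hu0
  · simpa using hy0
  · simpa using hyu
  · have f1 : 1 - v - 1 = -v := by ring
    have f2 : 1 - v - (1 - u) = -(v - u) := by ring
    have f3 : 1 - u - 1 = -u := by ring
    have f4 : 1 - u = -(u - 1) := by ring
    have f5 : 1 - v = -(v - 1) := by ring
    rw [f1, f2, f3, f4, f5]
    field_simp
    ring

/-! ### The residues of the associated systems -/

/-- The system with prescribed values of `z_0, z_x, z_1`. -/
def residueSystem (θ : Theta) (x y k z0 zx z1 : ℂ) : FuchsianSystem x :=
  { A0 := !![z0 + θ.t0 / 2, -(k * y / x);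
             z0 * x / (k * y) * (z0 + θ.t0), -(z0 + θ.t0 / 2)]
    Ax := !![zx + θ.tx / 2, -(k * (y - x) / (x * (x - 1)));
             x * (x - 1) * zx / (k * (y - x)) * (zx + θ.tx), -(zx + θ.tx / 2)]
    A1 := !![z1 + θ.t1 / 2, k * (y - 1) / (x - 1);
             -((x - 1) * z1 / (k * (y - 1))) * (z1 + θ.t1), -(z1 + θ.t1 / 2)] }

/-- The exponent `κ₂`. -/
def kappaTwo (θ : Theta) : ℂ := -(θ.t0 / 2 + θ.tx / 2 + θ.t1 / 2 + θ.tinf / 2)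

/-- The auxiliary variable conjugate to `y`. -/
def zTilde (θ : Theta) (x y p : ℂ) : ℂ :=
  1 / 2 * (x * (x - 1) / (y * (y - 1) * (y - x))) * p
    - 1 / 2 * (1 / (y - x) + θ.t0 / y + θ.tx / (y - x) + θ.t1 / (y - 1))

/-- The variable `z_0` as a function of the conjugate variable. -/
def zZero (θ : Theta) (x y zt : ℂ) : ℂ :=
  y / (x * θ.tinf) *
    (y * (y - 1) * (y - x) * zt ^ 2
      + (θ.t1 * (y - x) + x * θ.tx * (y - 1) - 2 * kappaTwo θ * (y - 1) * (y - x)) * zt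
      + kappaTwo θ ^ 2 * (y - x - 1) - kappaTwo θ * (θ.t1 + x * θ.tx))

/-- The variable `z_1` as a function of the conjugate variable. -/
def zOne (θ : Theta) (x y zt : ℂ) : ℂ :=
  -((y - 1) / ((x - 1) * θ.tinf)) *
    (y * (y - 1) * (y - x) * zt ^ 2
      + ((θ.t1 + θ.tinf) * (y - x) + x * θ.tx * (y - 1)
          - 2 * kappaTwo θ * (y - 1) * (y - x)) * zt
      + kappaTwo θ ^ 2 * (y - x) - kappaTwo θ * (θ.t1 + x * θ.tx)
      - kappaTwo θ * (kappaTwo θ + θ.tinf))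

/-- The variable `z_x` as a function of the conjugate variable. -/
def zEx (θ : Theta) (x y zt : ℂ) : ℂ :=
  (y - x) / (x * (x - 1) * θ.tinf) *
    (y * (y - 1) * (y - x) * zt ^ 2
      + (θ.t1 * (y - x) + x * (θ.tx + θ.tinf) * (y - 1)
          - 2 * kappaTwo θ * (y - 1) * (y - x)) * zt
      + kappaTwo θ ^ 2 * (y - 1) - kappaTwo θ * (θ.t1 + x * θ.tx)
      - x * kappaTwo θ * (kappaTwo θ + θ.tinf))

lemma jmuSystem_eq (θ : Theta) (x y p k : ℂ) :
    jmuSystem θ x y p k = residueSystem θ x y k (zZero θ x y (zTilde θ x y p))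
      (zEx θ x y (zTilde θ x y p)) (zOne θ x y (zTilde θ x y p)) :=
  rfl

lemma jmuSystem_trace (θ : Theta) (x y p k : ℂ) :
    (jmuSystem θ x y p k).A0.trace = 0 ∧ (jmuSystem θ x y p k).Ax.trace = 0 ∧
      (jmuSystem θ x y p k).A1.trace = 0 := by
  simp [jmuSystem, Matrix.trace_fin_two]

/-- In each residue the off-diagonal entries multiply to -z(z+θ), whatever z is, and (z+θ/2)² -
z(z+θ) = θ²/4. The eigenvalues are therefore ±θ/2. -/
lemma jmuSystem_det (θ : Theta) {x y p k : ℂ} (hx0 : x ≠ 0) (hx1 : x ≠ 1) (hy0 : y ≠ 0)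
    (hy1 : y ≠ 1) (hyx : y ≠ x) (hk : k ≠ 0) :
    (jmuSystem θ x y p k).A0.det = -(θ.t0 / 2) ^ 2 ∧
      (jmuSystem θ x y p k).Ax.det = -(θ.tx / 2) ^ 2 ∧
      (jmuSystem θ x y p k).A1.det = -(θ.t1 / 2) ^ 2 := by
  have e1 : y - 1 ≠ 0 := sub_ne_zero.mpr hy1
  have e2 : y - x ≠ 0 := sub_ne_zero.mpr hyx
  have e3 : x - 1 ≠ 0 := sub_ne_zero.mpr hx1
  rw [jmuSystem_eq]
  simp only [residueSystem, Matrix.det_fin_two_of]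
  refine ⟨?_, ?_, ?_⟩ <;> field_simp <;> ring

/-- The diagonal needs only z_0 + z_x + z_1 = κ₂, and the upper right entry does not involve the
z's. Only the vanishing of the lower left entry uses the separate quadratic formulas. The sum
determines the monodromy around all poles. -/
lemma jmuSystem_sum (θ : Theta) (hθ : θ.tinf ≠ 0) {x y p k : ℂ} (hx0 : x ≠ 0) (hx1 : x ≠ 1)
    (hy0 : y ≠ 0) (hy1 : y ≠ 1) (hyx : y ≠ x) (hk : k ≠ 0) :
    (jmuSystem θ x y p k).A0 + (jmuSystem θ x y p k).Ax + (jmuSystem θ x y p k).A1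
      = !![-(θ.tinf / 2), 0; 0, θ.tinf / 2] := by
  have e1 : y - 1 ≠ 0 := sub_ne_zero.mpr hy1
  have e2 : y - x ≠ 0 := sub_ne_zero.mpr hyx
  have e3 : x - 1 ≠ 0 := sub_ne_zero.mpr hx1
  rw [jmuSystem_eq]
  generalize zTilde θ x y p = zt
  have hz : zZero θ x y zt + zEx θ x y zt + zOne θ x y zt = kappaTwo θ := by
    simp only [zZero, zEx, zOne, kappaTwo]
    field_simp
    ring
  ext i j
  fin_cases i <;> fin_cases j
  · simp [residueSystem]
    linear_combination (norm := (simp only [kappaTwo]; ring)) hz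
  · simp [residueSystem]
    field_simp
    ring
  · simp [residueSystem, zZero, zEx, zOne, kappaTwo]
    field_simp
    ring
  · simp [residueSystem]
    linear_combination (norm := (simp only [kappaTwo]; ring)) -hz

lemma inv_diagonal_mul_mul {a : ℂ} (ha : a ≠ 0) (A : Matrix (Fin 2) (Fin 2) ℂ) :
    (!![a, 0; 0, 1] : Matrix (Fin 2) (Fin 2) ℂ)⁻¹ * A * !![a, 0; 0, 1]
      = !![A 0 0, a⁻¹ * A 0 1; A 1 0 * a, A 1 1] := by
  rw [Matrix.inv_def, Matrix.adjugate_fin_two_of, Matrix.det_fin_two_of]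
  ext i j
  fin_cases i <;> fin_cases j <;> simp [Matrix.mul_apply, Matrix.vecMul, dotProduct, Fin.sum_univ_two, ha]
  field_simp

lemma jmuSystem_sigma3 (θ : Theta) (hθ : θ.tinf ≠ 0) {x y p k k' : ℂ} (hx0 : x ≠ 0)
    (hx1 : x ≠ 1) (hy0 : y ≠ 0) (hy1 : y ≠ 1) (hyx : y ≠ x) (hk : k ≠ 0) (hk' : k' ≠ 0) :
    let S := jmuSystem θ x y p k
    let S' := jmuSystem (sigma3Theta θ) x⁻¹ (1 / x * y) (y - x * p) k'
    let K := sigma3Gauge x k k'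
    S'.A0 = K⁻¹ * S.A0 * K ∧ S'.Ax = K⁻¹ * S.A1 * K ∧ S'.A1 = K⁻¹ * S.Ax * K := by
  have e1 : y - 1 ≠ 0 := sub_ne_zero.mpr hy1
  have e2 : y - x ≠ 0 := sub_ne_zero.mpr hyx
  have e3 : x - 1 ≠ 0 := sub_ne_zero.mpr hx1
  have f1 : 1 / x * y - 1 = (y - x) / x := by field_simp
  have f2 : 1 / x * y - x⁻¹ = (y - 1) / x := by field_simp
  have f3 : x⁻¹ - 1 = -(x - 1) / x := by field_simp; ring
  -- This is the only place where the transformed derivative `y - x * p` enters; afterwards z̃ is a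
  -- free variable and the z's are permuted identically in it.
  have hzt : zTilde (sigma3Theta θ) x⁻¹ (1 / x * y) (y - x * p)
      = x * zTilde θ x y p := by
    simp only [zTilde, sigma3Theta, f1, f2, f3]
    field_simp
    ring
  have h0 : ∀ zt, zZero (sigma3Theta θ) x⁻¹ (1 / x * y) (x * zt) = zZero θ x y zt := by
    intro zt
    simp only [zZero, sigma3Theta, kappaTwo, f1, f2]
    field_simp
    ring
  have h1 : ∀ zt, zEx (sigma3Theta θ) x⁻¹ (1 / x * y) (x * zt) = zOne θ x y zt := by
    intro zt
    simp only [zEx, zOne, sigma3Theta, kappaTwo, f1, f2, f3]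
    field_simp
    ring
  have h2 : ∀ zt, zOne (sigma3Theta θ) x⁻¹ (1 / x * y) (x * zt) = zEx θ x y zt := by
    intro zt
    simp only [zEx, zOne, sigma3Theta, kappaTwo, f1, f2, f3]
    field_simp
    ring
  intro S S' K
  have hS : S = jmuSystem θ x y p k := rfl
  have hS' : S' = jmuSystem (sigma3Theta θ) x⁻¹ (1 / x * y) (y - x * p) k' := rfl
  have hK : K = !![k / (x * k'), 0; 0, 1] := rfl
  rw [hS, hS', hK, jmuSystem_eq, jmuSystem_eq, hzt, h0, h1, h2]
  simp only [inv_diagonal_mul_mul (div_ne_zero hk (mul_ne_zero hx0 hk'))]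
  generalize zZero θ x y _ = z0, zEx θ x y _ = zx, zOne θ x y _ = z1
  simp only [residueSystem, sigma3Theta, f1, f2, f3]
  refine ⟨?_, ?_, ?_⟩ <;> ext i j <;> fin_cases i <;> fin_cases j <;> simp <;> field_simp <;> ring

lemma jmuSystem_sigma1 (θ : Theta) (hθ : θ.tinf ≠ 0) {x y p k k' : ℂ} (hx0 : x ≠ 0)
    (hx1 : x ≠ 1) (hy0 : y ≠ 0) (hy1 : y ≠ 1) (hyx : y ≠ x) (hk : k ≠ 0) (hk' : k' ≠ 0) :
    let S := jmuSystem θ x y p k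
    let S' := jmuSystem (sigma1Theta θ) (1 - x) (1 - y) p k'
    let K := sigma1Gauge k k'
    S'.A0 = K⁻¹ * S.A1 * K ∧ S'.Ax = K⁻¹ * S.Ax * K ∧ S'.A1 = K⁻¹ * S.A0 * K := by
  have e1 : y - 1 ≠ 0 := sub_ne_zero.mpr hy1
  have e2 : y - x ≠ 0 := sub_ne_zero.mpr hyx
  have e3 : x - 1 ≠ 0 := sub_ne_zero.mpr hx1
  have f1 : 1 - y - 1 = -y := by ring
  have f2 : 1 - y - (1 - x) = -(y - x) := by ring
  have f3 : 1 - x - 1 = -x := by ring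
  have f4 : 1 - x = -(x - 1) := by ring
  have f5 : 1 - y = -(y - 1) := by ring
  have hzt : zTilde (sigma1Theta θ) (1 - x) (1 - y) p = -zTilde θ x y p := by
    simp only [zTilde, sigma1Theta, f1, f2, f3]
    rw [f4, f5]
    field_simp
    ring
  have h0 : ∀ zt, zZero (sigma1Theta θ) (1 - x) (1 - y) (-zt) = zOne θ x y zt := by
    intro zt
    simp only [zZero, zOne, sigma1Theta, kappaTwo, f1, f2]
    rw [f4, f5]
    field_simp
    ring
  have h1 : ∀ zt, zEx (sigma1Theta θ) (1 - x) (1 - y) (-zt) = zEx θ x y zt := by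
    intro zt
    simp only [zEx, sigma1Theta, kappaTwo, f1, f2, f3]
    rw [f4, f5]
    field_simp
    ring
  have h2 : ∀ zt, zOne (sigma1Theta θ) (1 - x) (1 - y) (-zt) = zZero θ x y zt := by
    intro zt
    simp only [zZero, zOne, sigma1Theta, kappaTwo, f1, f2, f3]
    rw [f4, f5]
    field_simp
    ring
  intro S S' K
  have hS : S = jmuSystem θ x y p k := rfl
  have hS' : S' = jmuSystem (sigma1Theta θ) (1 - x) (1 - y) p k' := rfl
  have hK : K = !![-(k / k'), 0; 0, 1] := rfl
  rw [hS, hS', hK, jmuSystem_eq, jmuSystem_eq, hzt, h0, h1, h2]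
  simp only [inv_diagonal_mul_mul (neg_ne_zero.mpr (div_ne_zero hk hk'))]
  generalize zZero θ x y _ = z0, zEx θ x y _ = zx, zOne θ x y _ = z1
  simp only [residueSystem, sigma1Theta, f1, f2, f3]
  rw [f4, f5]
  refine ⟨?_, ?_, ?_⟩ <;> ext i j <;> fin_cases i <;> fin_cases j <;> simp <;> field_simp <;> ring

/-! ### Linear differential equations in the complex domain -/

section LinearODE

open Metric

/-- A holomorphic linear equation `f' = A f` has solutions on small discs, with arbitrary initial
value at the centre. -/
theorem exists_hasDerivAt_linear {E : Type*} [NormedAddCommGroup E] [NormedSpace ℂ E]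
    [CompleteSpace E] {A : ℂ → E →L[ℂ] E} {z : ℂ} {r C : ℝ} (hr : 0 < r)
    (hA : DifferentiableOn ℂ A (ball z r)) (hC : ∀ w ∈ ball z r, ‖A w‖ ≤ C) (hCr : C * r < 1)
    (v : E) : ∃ f : ℂ → E, f z = v ∧ ∀ w ∈ ball z r, HasDerivAt f (A w (f w)) w := by
  have hz : z ∈ ball z r := mem_ball_self hr
  have hC0 : 0 ≤ C := (norm_nonneg _).trans (hC z hz)
  have hstep : ∀ d : {d : ℂ → E // DifferentiableOn ℂ d (ball z r)},
      ∃ e : {d : ℂ → E // DifferentiableOn ℂ d (ball z r)},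
        e.1 z = 0 ∧ ∀ w ∈ ball z r, HasDerivAt e.1 (A w (d.1 w)) w := by
    -- Picard step: the next term is the primitive of `A d` that vanishes at the centre; it exists
    -- because holomorphic functions on a disc have primitives.
    intro d
    obtain ⟨g, hg⟩ := (hA.clm_apply d.2).isExactOn_ball
    have hg' : ∀ w ∈ ball z r, HasDerivAt (fun w => g w - g z) (A w (d.1 w)) w :=
      fun w hw => (hg w hw).sub_const _
    exact ⟨⟨fun w => g w - g z, fun w hw => (hg' w hw).differentiableAt.differentiableWithinAt⟩,
      sub_self _, hg'⟩
  choose step hstep0 hstep1 using hstep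
  let d : ℕ → {d : ℂ → E // DifferentiableOn ℂ d (ball z r)} :=
    fun n => Nat.rec ⟨fun _ => v, differentiableOn_const v⟩ (fun _ e => step e) n
  have hd : ∀ n, d (n + 1) = step (d n) := fun n => rfl
  -- By the mean value inequality each integration costs a factor at most `C * r`, so the series of
  -- iterates is dominated by a geometric one.
  have hb : ∀ n, ∀ w ∈ ball z r, ‖(d n).1 w‖ ≤ (C * r) ^ n * ‖v‖ := by
    intro n
    induction n with
    | zero => intro w _; simp [d]
    | succ n ih =>
      intro w hw
      have h := (convex_ball z r).norm_image_sub_le_of_norm_hasDerivWithin_le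
        (C := C * ((C * r) ^ n * ‖v‖))
        (fun u hu => (hstep1 (d n) u hu).hasDerivWithinAt)
        (fun u hu => ((A u).le_opNorm _).trans
          (mul_le_mul (hC u hu) (ih u hu) (norm_nonneg _) hC0)) hz hw
      rw [hstep0, sub_zero, ← hd] at h
      have hw' : ‖w - z‖ ≤ r := by
        rw [← dist_eq_norm]
        exact (mem_ball.mp hw).le
      calc ‖(d (n + 1)).1 w‖ ≤ C * ((C * r) ^ n * ‖v‖) * ‖w - z‖ := h
        _ ≤ C * ((C * r) ^ n * ‖v‖) * r := by gcongr
        _ = (C * r) ^ (n + 1) * ‖v‖ := by ring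
  have hgeo : Summable fun n : ℕ => (C * r) ^ n * ‖v‖ :=
    (summable_geometric_of_lt_one (by positivity) hCr).mul_right _
  have hsum : ∀ w ∈ ball z r, Summable fun n => (d n).1 w := fun w hw =>
    hgeo.of_norm_bounded (fun n => hb n w hw)
  -- The term-by-term derivative is shifted by one: the constant term contributes 0 and term n+1
  -- contributes `A` applied to term n. Hence the differentiated series sums to `A` of the sum.
  let g' : ℕ → ℂ → E := fun n => Nat.casesOn n (fun _ => 0) (fun n w => A w ((d n).1 w))
  let u : ℕ → ℝ := fun n => Nat.casesOn n 0 (fun n => C * ((C * r) ^ n * ‖v‖))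
  have hu : Summable u := (summable_nat_add_iff 1).mp (hgeo.mul_left C)
  refine ⟨fun w => ∑' n, (d n).1 w, ?_, fun w hw => ?_⟩
  · change ∑' n, (d n).1 z = v
    rw [tsum_eq_single 0]
    · rfl
    intro n hn
    obtain ⟨m, rfl⟩ := Nat.exists_eq_succ_of_ne_zero hn
    exact hstep0 _
  · have hg' : ∀ n, ∀ w ∈ ball z r, ‖g' n w‖ ≤ u n := by
      rintro (_ | m) w hw
      · simp [g', u]
      · exact ((A w).le_opNorm _).trans
          (mul_le_mul (hC w hw) (hb m w hw) (norm_nonneg _) hC0)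
    have h := hasDerivAt_tsum_of_isPreconnected (g := fun n => (d n).1) (g' := g') hu isOpen_ball
      (convex_ball z r).isPreconnected
      (fun n w hw => by
        cases n with
        | zero => exact hasDerivAt_const w v
        | succ n => exact hstep1 (d n) w hw)
      hg' hz (hsum z hz) hw
    refine h.congr_deriv ?_
    have hs : Summable fun n => g' n w := by
      refine (summable_nat_add_iff 1).mp ?_
      exact (A w).summable (hsum w hw)
    rw [hs.tsum_eq_zero_add, (A w).map_tsum (hsum w hw)]
    simp [g']

end LinearODE

/-! ### Local solutions of the Fuchsian system and their Wronskian. -/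

section Solutions

attribute [local instance] Matrix.linftyOpNormedRing Matrix.linftyOpNormedAlgebra

open Metric

lemma hasDerivAt_matrix_iff {𝕜 : Type*} [NontriviallyNormedField 𝕜] [NormedAlgebra 𝕜 ℂ]
    {Φ : 𝕜 → Matrix (Fin 2) (Fin 2) ℂ} {D : Matrix (Fin 2) (Fin 2) ℂ} {w : 𝕜} :
    HasDerivAt Φ D w ↔ ∀ i j, HasDerivAt (fun l => Φ l i j) (D i j) w := by
  refine Iff.trans (hasDerivAt_pi (E' := fun _ : Fin 2 => Fin 2 → ℂ) (φ := Φ))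
    (forall_congr' fun i => ?_)
  exact hasDerivAt_pi

namespace FuchsianSystem

variable {x : ℂ} {S : FuchsianSystem x} {Φ Φ' : ℂ → Matrix (Fin 2) (Fin 2) ℂ}

/-- `Φ` solves the system at all points of `W`. -/
def SolvesOn (S : FuchsianSystem x) (Φ : ℂ → Matrix (Fin 2) (Fin 2) ℂ) (W : Set ℂ) : Prop :=
  ∀ w ∈ W, ∀ i j, HasDerivAt (fun l => Φ l i j) ((S.coeff w * Φ w) i j) w

/-- The residues have trace zero. -/
structure Traceless (S : FuchsianSystem x) : Prop where
  A0 : S.A0.trace = 0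
  Ax : S.Ax.trace = 0
  A1 : S.A1.trace = 0

lemma Traceless.coeff (hS : S.Traceless) (l : ℂ) : (S.coeff l).trace = 0 := by
  simp [FuchsianSystem.coeff, Matrix.trace_add, Matrix.trace_smul, hS.A0, hS.Ax, hS.A1]

lemma SolvesOn.hasDerivAt {W : Set ℂ} (h : S.SolvesOn Φ W) {w : ℂ} (hw : w ∈ W) :
    HasDerivAt Φ (S.coeff w * Φ w) w :=
  hasDerivAt_matrix_iff.mpr (h w hw)

lemma SolvesOn.mono {V W : Set ℂ} (h : S.SolvesOn Φ W) (hVW : V ⊆ W) : S.SolvesOn Φ V :=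
  fun w hw => h w (hVW hw)

lemma SolvesOn.isSolutionNear {W : Set ℂ} (h : S.SolvesOn Φ W) (hW : IsOpen W) {z : ℂ}
    (hz : z ∈ W) : S.IsSolutionNear Φ z := by
  filter_upwards [hW.mem_nhds hz] with w hw using h w hw

lemma IsSolutionNear.exists_ball {z : ℂ} (h : S.IsSolutionNear Φ z) :
    ∃ r > 0, S.SolvesOn Φ (ball z r) :=
  Metric.eventually_nhds_iff_ball.mp h

lemma IsSolutionNear.eventually {z : ℂ} (h : S.IsSolutionNear Φ z) :
    ∀ᶠ w in 𝓝 z, S.IsSolutionNear Φ w :=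
  eventually_eventually_nhds.mpr h

lemma IsSolutionNear.congr {z : ℂ} (h : S.IsSolutionNear Φ z) (he : Φ =ᶠ[𝓝 z] Φ') :
    S.IsSolutionNear Φ' z := by
  filter_upwards [h, eventually_eventually_nhds.mpr he] with w hw hew i j
  have h1 : (fun l => Φ l i j) =ᶠ[𝓝 w] fun l => Φ' l i j := by
    filter_upwards [hew] with l hl
    rw [hl]
  rw [← hew.self_of_nhds]
  exact (hw i j).congr_of_eventuallyEq h1.symm

lemma IsSolutionNear.continuousAt {z : ℂ} (h : S.IsSolutionNear Φ z) : ContinuousAt Φ z :=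
  (hasDerivAt_matrix_iff.mpr h.self_of_nhds).continuousAt

lemma IsSolutionNear.mul_right {z : ℂ} (h : S.IsSolutionNear Φ z)
    (C : Matrix (Fin 2) (Fin 2) ℂ) : S.IsSolutionNear (fun l => Φ l * C) z := by
  filter_upwards [h] with w hw
  rw [← hasDerivAt_matrix_iff (Φ := fun l => Φ l * C), ← mul_assoc]
  exact (hasDerivAt_matrix_iff.mpr hw).mul_const C

lemma IsFundamentalNear.congr {z : ℂ} (h : S.IsFundamentalNear Φ z) (he : Φ =ᶠ[𝓝 z] Φ') :
    S.IsFundamentalNear Φ' z :=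
  ⟨h.1.congr he, by rw [← he.self_of_nhds]; exact h.2⟩

lemma IsFundamentalNear.eventually {z : ℂ} (h : S.IsFundamentalNear Φ z) :
    ∀ᶠ w in 𝓝 z, S.IsFundamentalNear Φ w := by
  have hc : ContinuousAt (fun w => (Φ w).det) z :=
    (continuous_id.matrix_det.continuousAt).comp h.1.continuousAt
  filter_upwards [h.1.eventually, hc.eventually_ne h.2] with w h1 h2 using ⟨h1, h2⟩

/-- Two solutions with the same germ at a point of a connected open set agree on this set. -/
lemma SolvesOn.eqOn {W : Set ℂ} (hW : IsOpen W) (hc : IsPreconnected W) (h : S.SolvesOn Φ W)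
    (h' : S.SolvesOn Φ' W) {z : ℂ} (hz : z ∈ W) (he : Φ =ᶠ[𝓝 z] Φ') : Set.EqOn Φ Φ' W := by
  have hd : ∀ {Θ : ℂ → Matrix (Fin 2) (Fin 2) ℂ}, S.SolvesOn Θ W → AnalyticOnNhd ℂ Θ W :=
    fun hΘ => DifferentiableOn.analyticOnNhd
      (fun w hw => (hΘ.hasDerivAt hw).differentiableAt.differentiableWithinAt) hW
  exact (hd h).eqOn_of_preconnected_of_eventuallyEq (hd h') hc hz he

/-- The Wronskian of two solutions is constant. -/
lemma SolvesOn.wronskian (hS : S.Traceless) {W : Set ℂ} (hW : IsOpen W) (hc : IsPreconnected W)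
    (h : S.SolvesOn Φ W) (h' : S.SolvesOn Φ' W) :
    ∃ C, ∀ w ∈ W, (Φ w).adjugate * Φ' w = C := by
  have hd : ∀ w ∈ W, HasDerivAt (fun w => (Φ w).adjugate * Φ' w) 0 w := by
    intro w hw
    have h1 : HasDerivAt (fun w => (Φ w).adjugate) (S.coeff w * Φ w).adjugate w := by
      rw [hasDerivAt_matrix_iff]
      have h2 := h w hw
      intro i j
      simp only [Matrix.adjugate_fin_two]
      fin_cases i <;> fin_cases j
      · exact h2 1 1
      · exact (h2 0 1).neg
      · exact (h2 1 0).neg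
      · exact h2 0 0
    refine (h1.mul (h'.hasDerivAt hw)).congr_deriv ?_
    -- A traceless 2×2 matrix has adjugate equal to its negative, so the two terms of the product
    -- rule, -adj(Φ)AΦ' and adj(Φ)AΦ', cancel.
    have h3 : (S.coeff w).adjugate = -S.coeff w := by
      have h4 := hS.coeff w
      rw [Matrix.trace_fin_two] at h4
      rw [Matrix.adjugate_fin_two]
      ext i j
      fin_cases i <;> fin_cases j
      · simp; linear_combination h4
      · simp
      · simp
      · simp; linear_combination h4
    rw [Matrix.adjugate_mul_distrib, h3]
    noncomm_ring
  exact hW.exists_is_const_of_deriv_eq_zero hc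
    (fun w hw => (hd w hw).differentiableAt.differentiableWithinAt) (fun w hw => (hd w hw).deriv)

/-- The Wronskian of Φ with itself is det(Φ) times the identity. -/
lemma SolvesOn.det_eq (hS : S.Traceless) {W : Set ℂ} (hW : IsOpen W) (hc : IsPreconnected W)
    (h : S.SolvesOn Φ W) {w z : ℂ} (hw : w ∈ W) (hz : z ∈ W) : (Φ w).det = (Φ z).det := by
  obtain ⟨C, hC⟩ := h.wronskian hS hW hc h
  have h1 := (hC w hw).trans (hC z hz).symm
  rw [Matrix.adjugate_mul, Matrix.adjugate_mul] at h1
  simpa using congrFun (congrFun h1 0) 0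

/-- Every solution is a constant multiple of a fundamental one. -/
lemma IsFundamentalNear.exists_eq_mul (hS : S.Traceless) {z : ℂ} (h : S.IsFundamentalNear Φ z)
    (h' : S.IsSolutionNear Φ' z) : ∃ C, Φ' =ᶠ[𝓝 z] fun l => Φ l * C := by
  obtain ⟨r, hr, h1⟩ := Metric.eventually_nhds_iff_ball.mp (Filter.Eventually.and h.1 h')
  have h2 : S.SolvesOn Φ (ball z r) := fun w hw => (h1 w hw).1
  have h3 : S.SolvesOn Φ' (ball z r) := fun w hw => (h1 w hw).2
  have hc := (convex_ball z r).isPreconnected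
  obtain ⟨C, hC⟩ := h2.wronskian hS isOpen_ball hc h3
  refine ⟨(Φ z).det⁻¹ • C, ?_⟩
  filter_upwards [ball_mem_nhds z hr] with w hw
  rw [← hC w hw, Matrix.mul_smul, ← mul_assoc, Matrix.mul_adjugate, Matrix.smul_mul, one_mul,
    h2.det_eq hS isOpen_ball hc hw (mem_ball_self hr), smul_smul, inv_mul_cancel₀ h.2, one_smul]

/-- Solutions exist on discs whose radius depends only on the distance to the poles. -/
lemma exists_solvesOn (S : FuchsianSystem x) {d : ℝ} (hd : 0 < d) :
    ∃ R > 0, ∀ z : ℂ, d ≤ ‖z‖ → d ≤ ‖z - x‖ → d ≤ ‖z - 1‖ →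
      ∀ V : Matrix (Fin 2) (Fin 2) ℂ, ∃ Φ, Φ z = V ∧ S.SolvesOn Φ (ball z R) := by
  set a := ‖S.A0‖ + ‖S.Ax‖ + ‖S.A1‖ with ha
  have ha0 : 0 ≤ a := by positivity
  -- The bound d/2 keeps the disc at distance d/2 from the poles, whence the coefficient is at most
  -- (2/d)a. The second bound makes (2/d)a times the radius less than 1, as the Picard series
  -- requires; the summand 1 covers a = 0.
  refine ⟨min (d / 2) (1 / (2 / d * a + 1)), by positivity, fun z h0 hx h1 V => ?_⟩
  set R := min (d / 2) (1 / (2 / d * a + 1)) with hR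
  have hR0 : 0 < R := by positivity
  have hfar : ∀ p : ℂ, d ≤ ‖z - p‖ → ∀ w ∈ ball z R, w - p ≠ 0 ∧ ‖1 / (w - p)‖ ≤ 2 / d := by
    intro p hp w hw
    have h2 : ‖z - w‖ < d / 2 := by
      rw [← dist_eq_norm, dist_comm]
      exact (mem_ball.mp hw).trans_le (min_le_left _ _)
    have h3 : ‖z - p‖ ≤ ‖z - w‖ + ‖w - p‖ := norm_sub_le_norm_sub_add_norm_sub _ _ _
    have h4 : d / 2 ≤ ‖w - p‖ := by linarith
    refine ⟨norm_pos_iff.mp (by linarith), ?_⟩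
    rw [norm_div, norm_one, div_le_div_iff₀ (by linarith) hd]
    linarith
  have f0 := hfar 0 (by simpa using h0)
  have fx := hfar x hx
  have f1 := hfar 1 h1
  simp only [sub_zero] at f0
  have hdiff : DifferentiableOn ℂ S.coeff (ball z R) := by
    intro w hw
    have g0 := (f0 w hw).1
    have gx := (fx w hw).1
    have g1 := (f1 w hw).1
    unfold FuchsianSystem.coeff
    exact DifferentiableAt.differentiableWithinAt (by fun_prop (disch := assumption))
  have hbound : ∀ w ∈ ball z R, ‖S.coeff w‖ ≤ 2 / d * a := by
    intro w hw
    have g0 := (f0 w hw).2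
    have gx := (fx w hw).2
    have g1 := (f1 w hw).2
    calc ‖S.coeff w‖ ≤ ‖(1 / w) • S.A0‖ + ‖(1 / (w - x)) • S.Ax‖ + ‖(1 / (w - 1)) • S.A1‖ :=
          norm_add₃_le
      _ ≤ 2 / d * ‖S.A0‖ + 2 / d * ‖S.Ax‖ + 2 / d * ‖S.A1‖ := by
          rw [norm_smul, norm_smul, norm_smul]
          gcongr
      _ = 2 / d * a := by rw [ha]; ring
  obtain ⟨Φ, hΦ, hΦ'⟩ := exists_hasDerivAt_linear
    (A := fun w => ContinuousLinearMap.mul ℂ (Matrix (Fin 2) (Fin 2) ℂ) (S.coeff w)) hR0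
    ((ContinuousLinearMap.mul ℂ (Matrix (Fin 2) (Fin 2) ℂ)).differentiable.comp_differentiableOn
      hdiff)
    (fun w hw => (ContinuousLinearMap.opNorm_mul_apply_le ℂ _ _).trans (hbound w hw))
    (by
      have h5 : R ≤ 1 / (2 / d * a + 1) := min_le_right _ _
      have h6 : 0 ≤ 2 / d * a := by positivity
      calc 2 / d * a * R ≤ 2 / d * a * (1 / (2 / d * a + 1)) := by gcongr
        _ < 1 := by
          rw [mul_one_div, div_lt_one (by linarith)]
          linarith) V
  exact ⟨Φ, hΦ, fun w hw => hasDerivAt_matrix_iff.mp (hΦ' w hw)⟩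

end FuchsianSystem

end Solutions

/-! ### Analytic continuation of solutions -/

section Continuation

attribute [local instance] Matrix.linftyOpNormedRing Matrix.linftyOpNormedAlgebra

open Metric

/-- Each family has to be coherent only on its own side of `t₀`. At `t₀` itself, equality of germs
is an open condition, so it persists at the nearby points γ s. -/
lemma eventually_eq_glue {E : Type*} {γ : I → ℂ} (hγ : Continuous γ) {F G : I → ℂ → E} {t₀ : I}
    (hF : ∀ t, ∀ᶠ s in 𝓝 t, s ≤ t₀ → F s =ᶠ[𝓝 (γ s)] F t)
    (hG : ∀ t, ∀ᶠ s in 𝓝 t, t₀ ≤ s → G s =ᶠ[𝓝 (γ s)] G t)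
    (h : F t₀ =ᶠ[𝓝 (γ t₀)] G t₀) (t : I) :
    ∀ᶠ s in 𝓝 t, (if s ≤ t₀ then F s else G s) =ᶠ[𝓝 (γ s)] if t ≤ t₀ then F t else G t := by
  rcases lt_trichotomy t t₀ with ht | rfl | ht
  · filter_upwards [hF t, eventually_lt_nhds ht] with s hs hst
    rw [if_pos hst.le, if_pos ht.le]
    exact hs hst.le
  · have h' := hγ.continuousAt.eventually (eventually_eventually_nhds.mpr h)
    filter_upwards [hF t, hG t, h'] with s h1 h2 h3
    rw [if_pos le_rfl]
    split_ifs with h4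
    · exact h1 h4
    · exact (h2 (not_le.mp h4).le).trans (EventuallyEq.symm h3)
  · filter_upwards [hG t, eventually_gt_nhds ht] with s hs hst
    rw [if_neg hst.not_ge, if_neg ht.not_ge]
    exact hs hst.le

namespace FuchsianSystem

variable {x : ℂ} {S : FuchsianSystem x}

/-- The germs of `F t` at `γ t` are solutions continuing each other. -/
def Continues (S : FuchsianSystem x) (γ : I → ℂ) (F : I → ℂ → Matrix (Fin 2) (Fin 2) ℂ) : Prop :=
  ∀ t, S.IsSolutionNear (F t) (γ t) ∧ ∀ᶠ s in 𝓝 t, F s =ᶠ[𝓝 (γ s)] F t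

/-- Agreement of the two germs is locally constant in t, by the identity theorem on a disc where
both are solutions, and the interval is connected. -/
lemma Continues.eventuallyEq {γ : I → ℂ} (hγ : Continuous γ)
    {F F' : I → ℂ → Matrix (Fin 2) (Fin 2) ℂ} (hF : S.Continues γ F) (hF' : S.Continues γ F')
    {t₀ : I} (h : F t₀ =ᶠ[𝓝 (γ t₀)] F' t₀) (t : I) : F t =ᶠ[𝓝 (γ t)] F' t := by
  have hloc : IsLocallyConstant fun t => (F t =ᶠ[𝓝 (γ t)] F' t) := by
    rw [IsLocallyConstant.iff_eventually_eq]
    intro t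
    obtain ⟨r, hr, hb⟩ := Metric.eventually_nhds_iff_ball.mp
      (Filter.Eventually.and (hF t).1 (hF' t).1)
    filter_upwards [(hF t).2, (hF' t).2, hγ.continuousAt.eventually (ball_mem_nhds (γ t) hr)]
      with s h1 h2 h3
    have key : (F t =ᶠ[𝓝 (γ s)] F' t) ↔ F t =ᶠ[𝓝 (γ t)] F' t := by
      have hW : ∀ {p q : ℂ}, p ∈ ball (γ t) r → q ∈ ball (γ t) r → F t =ᶠ[𝓝 p] F' t →
          F t =ᶠ[𝓝 q] F' t := fun hp hq he =>
        (SolvesOn.eqOn isOpen_ball (convex_ball _ r).isPreconnected (S := S)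
          (fun w hw => (hb w hw).1) (fun w hw => (hb w hw).2) hp he).eventuallyEq_of_mem
          (isOpen_ball.mem_nhds hq)
      exact ⟨hW h3 (mem_ball_self hr), hW (mem_ball_self hr) h3⟩
    refine propext (Iff.trans ?_ key)
    exact ⟨fun h => h1.symm.trans (h.trans h2), fun h => h1.trans (h.trans h2.symm)⟩
  have := hloc.apply_eq_of_preconnectedSpace t₀ t
  exact this.mp h

lemma SolvesOn.mul_right {Φ : ℂ → Matrix (Fin 2) (Fin 2) ℂ} {W : Set ℂ} (h : S.SolvesOn Φ W)
    (C : Matrix (Fin 2) (Fin 2) ℂ) : S.SolvesOn (fun l => Φ l * C) W := by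
  intro w hw
  rw [← hasDerivAt_matrix_iff (Φ := fun l => Φ l * C), ← mul_assoc]
  exact (h.hasDerivAt hw).mul_const C

/-- Germs of solutions extend to discs whose radius depends only on the distance to the poles. -/
lemma exists_solvesOn_eventuallyEq (hS : S.Traceless) {d : ℝ} (hd : 0 < d) :
    ∃ R > 0, ∀ z : ℂ, d ≤ ‖z‖ → d ≤ ‖z - x‖ → d ≤ ‖z - 1‖ →
      ∀ Φ, S.IsSolutionNear Φ z → ∃ G, G =ᶠ[𝓝 z] Φ ∧ S.SolvesOn G (ball z R) := by
  obtain ⟨R, hR, h⟩ := S.exists_solvesOn hd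
  refine ⟨R, hR, fun z h0 hx h1 Φ hΦ => ?_⟩
  -- The solution with value 1 at z is fundamental and lives on the whole disc; every germ of a
  -- solution is a constant right multiple of it and so extends as far.
  obtain ⟨V, hV, hV'⟩ := h z h0 hx h1 1
  have hf : S.IsFundamentalNear V z :=
    ⟨hV'.isSolutionNear isOpen_ball (mem_ball_self hR), by simp [hV]⟩
  obtain ⟨C, hC⟩ := hf.exists_eq_mul hS hΦ
  exact ⟨_, hC.symm, hV'.mul_right C⟩

lemma exists_isFundamentalNear (S : FuchsianSystem x) (c : PuncturedPlane x) :
    ∃ Φ, S.IsFundamentalNear Φ c := by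
  obtain ⟨h0, hx, h1⟩ := c.2
  obtain ⟨R, hR, h⟩ := S.exists_solvesOn
    (d := min ‖(c : ℂ)‖ (min ‖(c : ℂ) - x‖ ‖(c : ℂ) - 1‖))
    (lt_min (norm_pos_iff.mpr h0) (lt_min (norm_pos_iff.mpr (sub_ne_zero.mpr hx))
      (norm_pos_iff.mpr (sub_ne_zero.mpr h1))))
  obtain ⟨V, hV, hV'⟩ := h c (min_le_left _ _) ((min_le_right _ _).trans (min_le_left _ _))
    ((min_le_right _ _).trans (min_le_right _ _)) 1
  exact ⟨V, hV'.isSolutionNear isOpen_ball (mem_ball_self hR), by simp [hV]⟩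

lemma exists_forall_le_norm_sub {γ : I → ℂ} (hγ : Continuous γ) {p : ℂ} (hp : ∀ t, γ t ≠ p) :
    ∃ d > 0, ∀ t, d ≤ ‖γ t - p‖ := by
  obtain ⟨t₀, -, h⟩ := isCompact_univ.exists_isMinOn (f := fun t => ‖γ t - p‖)
    Set.univ_nonempty (by fun_prop)
  exact ⟨_, norm_pos_iff.mpr (sub_ne_zero.mpr (hp t₀)), fun t => h (Set.mem_univ t)⟩

/-- Continuation along a path, by solutions on discs of a fixed radius. -/
lemma exists_continues_ball (hS : S.Traceless) {γ : I → PuncturedPlane x} (hγ : Continuous γ)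
    {Φ : ℂ → Matrix (Fin 2) (Fin 2) ℂ} (hΦ : S.IsSolutionNear Φ (γ 0)) :
    ∃ ρ > 0, ∃ F : I → ℂ → Matrix (Fin 2) (Fin 2) ℂ, F 0 =ᶠ[𝓝 (γ 0 : ℂ)] Φ ∧
      (∀ t, ∀ᶠ s in 𝓝 t, F s =ᶠ[𝓝 (γ s : ℂ)] F t) ∧
      ∀ t, S.SolvesOn (F t) (ball (γ t) ρ) := by
  have hγ' : Continuous fun t => (γ t : ℂ) := continuous_subtype_val.comp hγ
  obtain ⟨d0, hd0, h0⟩ := exists_forall_le_norm_sub hγ' (fun t => (γ t).2.1)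
  obtain ⟨dx, hdx, hx⟩ := exists_forall_le_norm_sub hγ' (fun t => (γ t).2.2.1)
  obtain ⟨d1, hd1, h1⟩ := exists_forall_le_norm_sub hγ' (fun t => (γ t).2.2.2)
  obtain ⟨R, hR, hext⟩ := exists_solvesOn_eventuallyEq hS (d := min d0 (min dx d1))
    (by positivity)
  replace hext : ∀ t : I, ∀ Φ, S.IsSolutionNear Φ (γ t) →
      ∃ G, G =ᶠ[𝓝 (γ t : ℂ)] Φ ∧ S.SolvesOn G (ball (γ t) R) := fun t =>
    hext (γ t) ((min_le_left _ _).trans (by simpa using h0 t))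
      (((min_le_right _ _).trans (min_le_left _ _)).trans (hx t))
      (((min_le_right _ _).trans (min_le_right _ _)).trans (h1 t))
  obtain ⟨δ, hδ, hunif⟩ := Metric.uniformContinuous_iff.mp
    (CompactSpace.uniformContinuous_of_continuous hγ') (R / 2) (by positivity)
  obtain ⟨N, hN⟩ := exists_nat_one_div_lt hδ
  refine ⟨R / 2, by positivity, ?_⟩
  have hball : ∀ s t : I, dist s t < δ → ball (γ s : ℂ) (R / 2) ⊆ ball (γ t) R := by
    intro s t hst
    refine ball_subset_ball' ?_
    linarith [hunif hst]
  -- Induction over time steps of length 1/(N+1) < δ. The family is coherent at all times but is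
  -- required to solve the system only up to time k/(N+1). Beyond that time it is replaced by one
  -- extension to a disc of radius R, which contains the discs of radius R/2 for one more step.
  suffices H : ∀ k : ℕ, ∃ F : I → ℂ → Matrix (Fin 2) (Fin 2) ℂ, F 0 =ᶠ[𝓝 (γ 0 : ℂ)] Φ ∧
      (∀ t, ∀ᶠ s in 𝓝 t, F s =ᶠ[𝓝 (γ s : ℂ)] F t) ∧
      ∀ t : I, (t : ℝ) ≤ k * (1 / ((N : ℝ) + 1)) → S.SolvesOn (F t) (ball (γ t) (R / 2)) by
    obtain ⟨F, hF0, hF1, hF2⟩ := H (N + 1)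
    refine ⟨F, hF0, hF1, fun t => hF2 t ?_⟩
    have hN0 : (N : ℝ) + 1 ≠ 0 := by positivity
    push_cast
    rw [mul_one_div_cancel hN0]
    exact t.2.2
  intro k
  induction k with
  | zero =>
    obtain ⟨G, hG, hG'⟩ := hext 0 Φ hΦ
    refine ⟨fun _ => G, hG, fun t => Eventually.of_forall fun s => EventuallyEq.rfl,
      fun t ht => ?_⟩
    have ht0 : t = 0 := by
      apply Subtype.ext
      apply le_antisymm _ t.2.1
      simpa using ht
    rw [ht0]
    exact hG'.mono (ball_subset_ball (by linarith))
  | succ k ih =>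
    obtain ⟨F, hF0, hF1, hF2⟩ := ih
    by_cases hk : (k : ℝ) * (1 / ((N : ℝ) + 1)) ≤ 1
    · let t₀ : I := ⟨(k : ℝ) * (1 / ((N : ℝ) + 1)), by positivity, hk⟩
      have hsol : S.IsSolutionNear (F t₀) (γ t₀) :=
        (hF2 t₀ le_rfl).isSolutionNear isOpen_ball (mem_ball_self (by positivity))
      obtain ⟨G, hG, hG'⟩ := hext t₀ _ hsol
      refine ⟨fun t => if t ≤ t₀ then F t else G, ?_, ?_, ?_⟩
      · dsimp only
        rw [if_pos unitInterval.nonneg']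
        exact hF0
      · exact eventually_eq_glue hγ' (G := fun _ => G)
          (fun t => (hF1 t).mono fun s hs _ => hs)
          (fun t => Eventually.of_forall fun s _ => EventuallyEq.rfl) hG.symm
      · intro t ht
        dsimp only
        split_ifs with htt
        · exact hF2 t htt
        · refine hG'.mono (hball _ _ (lt_of_le_of_lt ?_ hN))
          have h2 : (t₀ : ℝ) < t := not_le.mp htt
          rw [Subtype.dist_eq, Real.dist_eq, abs_of_pos (by linarith)]
          have h3 : (t₀ : ℝ) = (k : ℝ) * (1 / ((N : ℝ) + 1)) := rfl
          rw [h3]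
          push_cast at ht
          linarith
    · refine ⟨F, hF0, hF1, fun t _ => hF2 t ?_⟩
      exact t.2.2.trans (not_le.mp hk).le

/-- A continuation along a path also works along all neighbouring paths. -/
lemma exists_eventually_continues (hS : S.Traceless) {X : Type*} [TopologicalSpace X]
    {H : X × I → PuncturedPlane x} (hH : Continuous H) (s₀ : X)
    {Φ : ℂ → Matrix (Fin 2) (Fin 2) ℂ} (hΦ : S.IsSolutionNear Φ (H (s₀, 0))) :
    ∃ F : I → ℂ → Matrix (Fin 2) (Fin 2) ℂ, F 0 =ᶠ[𝓝 (H (s₀, 0) : ℂ)] Φ ∧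
      ∀ᶠ s in 𝓝 s₀, S.Continues (fun t => H (s, t)) F := by
  obtain ⟨ρ, hρ, F, hF0, hF1, hF2⟩ := exists_continues_ball hS
    (γ := fun t => H (s₀, t)) (by fun_prop) hΦ
  refine ⟨F, hF0, ?_⟩
  have hH' : Continuous fun p => (H p : ℂ) := continuous_subtype_val.comp hH
  -- By compactness of the interval, a neighbouring path stays uniformly inside the discs on which
  -- the old family already solves the system, so the same family serves it.
  have hnear : ∀ᶠ s in 𝓝 s₀, ∀ t ∈ (Set.univ : Set I),
      dist (H (s, t) : ℂ) (H (s₀, t)) < ρ := by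
    refine isCompact_univ.eventually_forall_of_forall_eventually fun t _ => ?_
    have hc : Continuous fun p : X × I => dist (H p : ℂ) (H (s₀, p.2)) :=
      hH'.dist (hH'.comp (by fun_prop))
    exact hc.continuousAt.eventually_lt continuousAt_const (by simpa using hρ)
  filter_upwards [hnear] with s hs t
  refine ⟨(hF2 t).isSolutionNear isOpen_ball (mem_ball.mpr (hs t trivial)), ?_⟩
  have h1 : ∀ᶠ u in 𝓝 t, (H (s, u) : ℂ) ∈ ball (H (s₀, t) : ℂ) ρ := by
    have hc : Continuous fun u => (H (s, u) : ℂ) := hH'.comp (by fun_prop)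
    exact hc.continuousAt.eventually (isOpen_ball.mem_nhds (mem_ball.mpr (hs t trivial)))
  have h2 : ∀ᶠ u in 𝓝 t, (H (s₀, u) : ℂ) ∈ ball (H (s₀, t) : ℂ) ρ := by
    have hc : Continuous fun u => (H (s₀, u) : ℂ) := hH'.comp (by fun_prop)
    exact hc.continuousAt.eventually (ball_mem_nhds _ hρ)
  filter_upwards [hF1 t, h1, h2] with u hu hu1 hu2
  -- The germs agree at the point of the old path; the intersection of the two discs is convex, so
  -- they agree also at the point of the new path.
  have hopen : IsOpen (ball (H (s₀, u) : ℂ) ρ ∩ ball (H (s₀, t) : ℂ) ρ) :=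
    isOpen_ball.inter isOpen_ball
  exact (SolvesOn.eqOn hopen ((convex_ball _ ρ).inter (convex_ball _ ρ)).isPreconnected
    ((hF2 u).mono Set.inter_subset_left) ((hF2 t).mono Set.inter_subset_right)
    ⟨mem_ball_self hρ, hu2⟩ hu).eventuallyEq_of_mem
    (hopen.mem_nhds ⟨mem_ball.mpr (hs u trivial), hu1⟩)

/-- Analytic continuation along `γ` turns the germ of `Φ` into the germ of `Φ'`. -/
def IsContinuation (S : FuchsianSystem x) {a c : PuncturedPlane x} (γ : Path a c)
    (Φ Φ' : ℂ → Matrix (Fin 2) (Fin 2) ℂ) : Prop :=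
  ∃ F : I → ℂ → Matrix (Fin 2) (Fin 2) ℂ,
    (F 0 =ᶠ[𝓝 (a : ℂ)] Φ) ∧ (F 1 =ᶠ[𝓝 (c : ℂ)] Φ') ∧ S.Continues (fun t => (γ t : ℂ)) F

namespace IsContinuation

variable {a b c : PuncturedPlane x} {γ : Path a b} {γ' : Path b c}
  {Φ Φ' Φ'' : ℂ → Matrix (Fin 2) (Fin 2) ℂ}

lemma congr_right (h : S.IsContinuation γ Φ Φ') (he : Φ' =ᶠ[𝓝 (b : ℂ)] Φ'') :
    S.IsContinuation γ Φ Φ'' := by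
  obtain ⟨F, h0, h1, hF⟩ := h
  exact ⟨F, h0, h1.trans he, hF⟩

lemma congr_left (h : S.IsContinuation γ Φ Φ') (he : Φ =ᶠ[𝓝 (a : ℂ)] Φ'') :
    S.IsContinuation γ Φ'' Φ' := by
  obtain ⟨F, h0, h1, hF⟩ := h
  exact ⟨F, h0.trans he, h1, hF⟩

lemma isSolutionNear_left (h : S.IsContinuation γ Φ Φ') : S.IsSolutionNear Φ a := by
  obtain ⟨F, h0, -, hF⟩ := h
  have := (hF 0).1
  simp only [Path.source] at this
  exact this.congr h0

lemma isSolutionNear_right (h : S.IsContinuation γ Φ Φ') : S.IsSolutionNear Φ' b := by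
  obtain ⟨F, -, h1, hF⟩ := h
  have := (hF 1).1
  simp only [Path.target] at this
  exact this.congr h1

lemma continuous_coe (γ : Path a b) : Continuous fun t => (γ t : ℂ) :=
  continuous_subtype_val.comp γ.continuous

lemma eventuallyEq (h : S.IsContinuation γ Φ Φ') (h' : S.IsContinuation γ Φ Φ'') :
    Φ' =ᶠ[𝓝 (b : ℂ)] Φ'' := by
  obtain ⟨F, h0, h1, hF⟩ := h
  obtain ⟨F', h0', h1', hF'⟩ := h'
  have h2 := hF.eventuallyEq (continuous_coe γ) hF' (t₀ := 0)
    (by rw [Path.source]; exact h0.trans h0'.symm) 1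
  rw [Path.target] at h2
  exact h1.symm.trans (h2.trans h1')

lemma mul_right (h : S.IsContinuation γ Φ Φ') (C : Matrix (Fin 2) (Fin 2) ℂ) :
    S.IsContinuation γ (fun l => Φ l * C) (fun l => Φ' l * C) := by
  obtain ⟨F, h0, h1, hF⟩ := h
  have key : ∀ {Θ Θ' : ℂ → Matrix (Fin 2) (Fin 2) ℂ} {z : ℂ}, Θ =ᶠ[𝓝 z] Θ' →
      (fun l => Θ l * C) =ᶠ[𝓝 z] fun l => Θ' l * C := fun h => h.mono fun l hl => by
    simp only [hl]
  exact ⟨fun t l => F t l * C, key h0, key h1, fun t =>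
    ⟨(hF t).1.mul_right C, (hF t).2.mono fun s hs => key hs⟩⟩

lemma symm (h : S.IsContinuation γ Φ Φ') : S.IsContinuation γ.symm Φ' Φ := by
  obtain ⟨F, h0, h1, hF⟩ := h
  refine ⟨fun t => F (unitInterval.symm t), by simpa using h1, by simpa using h0, fun t =>
    ⟨(hF _).1, ?_⟩⟩
  exact unitInterval.continuous_symm.continuousAt.eventually (hF (unitInterval.symm t)).2

lemma trans (h : S.IsContinuation γ Φ Φ') (h' : S.IsContinuation γ' Φ' Φ'') :
    S.IsContinuation (γ.trans γ') Φ Φ'' := by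
  obtain ⟨F, h0, h1, hF⟩ := h
  obtain ⟨F', h0', h1', hF'⟩ := h'
  let m : I := ⟨1 / 2, by norm_num, by norm_num⟩
  -- The clamped reparametrisations are defined and continuous for all times, so that coherence can
  -- be pulled back without endpoint cases.
  let q : I → I := fun t => Set.projIcc 0 1 zero_le_one (2 * (t : ℝ))
  let q' : I → I := fun t => Set.projIcc 0 1 zero_le_one (2 * (t : ℝ) - 1)
  have hq : Continuous q := continuous_projIcc.comp (by fun_prop)
  have hq' : Continuous q' := continuous_projIcc.comp (by fun_prop)
  have e0 : q 0 = 0 := by simp [q]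
  have em : q m = 1 := by simp [q, m]
  have em' : q' m = 0 := by simp [q', m]
  have e1 : q' 1 = 1 := by
    simp only [q', Set.Icc.coe_one]
    norm_num
  have hle : ∀ t ≤ m, (γ.trans γ') t = γ (q t) := by
    intro t ht
    have ht' : (t : ℝ) ≤ 1 / 2 := ht
    rw [Path.trans_apply, dif_pos ht']
    congr 1
    exact (Set.projIcc_of_mem _ ⟨by linarith [t.2.1], by linarith⟩).symm
  have hge : ∀ t, m ≤ t → (γ.trans γ') t = γ' (q' t) := by
    intro t ht
    rcases ht.eq_or_lt with rfl | ht
    · rw [hle m le_rfl, em, em', Path.source, Path.target]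
    · have ht' : (1 / 2 : ℝ) < t := ht
      rw [Path.trans_apply, dif_neg (not_le.mpr ht')]
      congr 1
      exact (Set.projIcc_of_mem _ ⟨by linarith, by linarith [t.2.2]⟩).symm
  refine ⟨fun t => if t ≤ m then F (q t) else F' (q' t), ?_, ?_, fun t => ⟨?_, ?_⟩⟩
  · dsimp only
    rw [if_pos unitInterval.nonneg', e0]
    exact h0
  · have h1m : ¬ (1 : I) ≤ m := by
      rw [not_le]
      change (1 / 2 : ℝ) < 1
      norm_num
    dsimp only
    rw [if_neg h1m, e1]
    exact h1'
  · dsimp only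
    split_ifs with ht
    · rw [hle t ht]
      exact (hF _).1
    · rw [hge t (not_le.mp ht).le]
      exact (hF' _).1
  · refine eventually_eq_glue (continuous_coe (γ.trans γ')) (F := fun t => F (q t))
      (G := fun t => F' (q' t)) (fun t => ?_) (fun t => ?_) ?_ t
    · filter_upwards [hq.continuousAt.eventually (hF (q t)).2] with s hs hsm
      rw [hle s hsm]
      exact hs
    · filter_upwards [hq'.continuousAt.eventually (hF' (q' t)).2] with s hs hsm
      rw [hge s hsm]
      exact hs
    · rw [hle m le_rfl, em, em', Path.target]
      exact h1.trans h0'.symm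

lemma _root_.FuchsianSystem.exists_isContinuation (hS : S.Traceless) (γ : Path a b)
    (hΦ : S.IsSolutionNear Φ a) : ∃ Φ', S.IsContinuation γ Φ Φ' := by
  obtain ⟨ρ, hρ, F, h0, h1, h2⟩ := exists_continues_ball hS γ.continuous
    (by rw [Path.source]; exact hΦ)
  rw [Path.source] at h0
  exact ⟨F 1, F, h0, EventuallyEq.rfl, fun t =>
    ⟨(h2 t).isSolutionNear Metric.isOpen_ball (Metric.mem_ball_self hρ), h1 t⟩⟩

/-- The monodromy theorem. -/
lemma of_homotopic (hS : S.Traceless) (h : S.IsContinuation γ Φ Φ') {γ₁ : Path a b}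
    (hγ : γ.Homotopic γ₁) : S.IsContinuation γ₁ Φ Φ' := by
  obtain ⟨H⟩ := hγ
  have hsol := h.isSolutionNear_left
  -- One family of germs continues Φ along all curves of the homotopy near `s₀`. These share their
  -- endpoints, so they all end in the same germ `F 1`.
  have hloc : IsLocallyConstant fun s => S.IsContinuation (H.eval s) Φ Φ' := by
    rw [IsLocallyConstant.iff_eventually_eq]
    intro s₀
    obtain ⟨F, h0, hF⟩ := exists_eventually_continues hS (H := H) H.continuous s₀ (Φ := Φ)
      (by rw [H.source]; exact hsol)
    rw [H.source] at h0
    have key : ∀ s, S.Continues (fun t => (H (s, t) : ℂ)) F →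
        (S.IsContinuation (H.eval s) Φ Φ' ↔ F 1 =ᶠ[𝓝 (b : ℂ)] Φ') := by
      intro s hs
      have h1 : S.IsContinuation (H.eval s) Φ (F 1) := ⟨F, h0, EventuallyEq.rfl, hs⟩
      exact ⟨fun h => h1.eventuallyEq h, fun h => h1.congr_right h⟩
    filter_upwards [hF] with s hs
    rw [key s hs, key s₀ hF.self_of_nhds]
  have h2 := hloc.apply_eq_of_preconnectedSpace 0 1
  simp only [H.eval_zero, H.eval_one] at h2
  exact h2.mp h

/-- The determinant of the current germ at the current point is locally constant along the path
because the residues are traceless. -/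
lemma det_eq (hS : S.Traceless) (h : S.IsContinuation γ Φ Φ') :
    (Φ' (b : ℂ)).det = (Φ (a : ℂ)).det := by
  obtain ⟨F, h0, h1, hF⟩ := h
  have hloc : IsLocallyConstant fun t => (F t (γ t)).det := by
    rw [IsLocallyConstant.iff_eventually_eq]
    intro t
    obtain ⟨r, hr, hb⟩ := (hF t).1.exists_ball
    filter_upwards [(hF t).2, (continuous_coe γ).continuousAt.eventually
      (Metric.ball_mem_nhds (γ t : ℂ) hr)] with s hs hsr
    rw [hs.self_of_nhds]
    exact hb.det_eq hS Metric.isOpen_ball (convex_ball _ r).isPreconnected hsr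
      (Metric.mem_ball_self hr)
  have h2 := hloc.apply_eq_of_preconnectedSpace 1 0
  simp only [Path.source, Path.target] at h2
  rwa [h0.self_of_nhds, h1.self_of_nhds] at h2

lemma isFundamentalNear (hS : S.Traceless) (h : S.IsContinuation γ Φ Φ')
    (hΦ : S.IsFundamentalNear Φ a) : S.IsFundamentalNear Φ' b :=
  ⟨h.isSolutionNear_right, by rw [h.det_eq hS]; exact hΦ.2⟩

end IsContinuation

end FuchsianSystem

/-! ### Monodromy matrices -/

section Monodromy

open FuchsianSystem

variable {x : ℂ} {S : FuchsianSystem x} {b c : PuncturedPlane x}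
  {Ψ Φ : ℂ → Matrix (Fin 2) (Fin 2) ℂ} {γ γ' : Path b b} {M M' : Matrix (Fin 2) (Fin 2) ℂ}

lemma IsMonodromy.eq (hΨ : (Ψ b).det ≠ 0) (h : IsMonodromy S Ψ γ M)
    (h' : IsMonodromy S Ψ γ M') : M = M' := by
  have h1 := (IsContinuation.eventuallyEq (S := S) h h').self_of_nhds
  have h2 : IsUnit (Ψ b) := (Matrix.isUnit_iff_isUnit_det _).mpr hΨ.isUnit
  exact h2.mul_left_cancel h1

lemma exists_isMonodromy (hS : S.Traceless) (hΨ : S.IsFundamentalNear Ψ b) (γ : Path b b) :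
    ∃ M, IsMonodromy S Ψ γ M := by
  obtain ⟨Φ, hΦ⟩ := exists_isContinuation hS γ hΨ.1
  obtain ⟨M, hM⟩ := hΨ.exists_eq_mul hS hΦ.isSolutionNear_right
  exact ⟨M, hΦ.congr_right hM⟩

lemma IsMonodromy.det (hS : S.Traceless) (hΨ : (Ψ b).det ≠ 0) (h : IsMonodromy S Ψ γ M) :
    M.det = 1 := by
  have h1 := IsContinuation.det_eq hS h
  rw [Matrix.det_mul] at h1
  exact mul_left_cancel₀ hΨ (by rw [h1, mul_one])

/-- Continuation commutes with right multiplication by constants: after γ the germ is Ψ M, and γ'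
turns it into (Ψ M') M. Products of loops are therefore reversed. -/
lemma IsMonodromy.trans (h : IsMonodromy S Ψ γ M) (h' : IsMonodromy S Ψ γ' M') :
    IsMonodromy S Ψ (γ.trans γ') (M' * M) := by
  have h1 := IsContinuation.trans h (IsContinuation.mul_right h' M)
  simp only [mul_assoc] at h1
  exact h1

lemma IsMonodromy.symm (hM : M.det ≠ 0) (h : IsMonodromy S Ψ γ M) :
    IsMonodromy S Ψ γ.symm M⁻¹ := by
  have h1 := IsContinuation.symm (IsContinuation.mul_right h M⁻¹)
  simp only [mul_assoc, Matrix.mul_nonsing_inv M hM.isUnit, mul_one] at h1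
  exact h1

lemma IsMonodromy.of_homotopic (hS : S.Traceless) (h : IsMonodromy S Ψ γ M)
    (hγ : γ.Homotopic γ') : IsMonodromy S Ψ γ' M :=
  IsContinuation.of_homotopic hS h hγ

/-- Moving to the circle along δ replaces Ψ by its continuation Φ and does not change the matrix. -/
lemma IsMonodromy.conj {δ : Path b c} {ω : Path c c} (hδ : S.IsContinuation δ Ψ Φ)
    (hω : IsMonodromy S Φ ω M) : IsMonodromy S Ψ (δ.trans (ω.trans δ.symm)) M :=
  hδ.trans (IsContinuation.trans hω (IsContinuation.symm hδ |>.mul_right M))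

/-- The trace of the monodromy along a loop does not depend on the fundamental solution. -/
lemma IsMonodromy.trace_eq (hS : S.Traceless) (hΨ : S.IsFundamentalNear Ψ b)
    (hΦ : S.IsFundamentalNear Φ b) (h : IsMonodromy S Ψ γ M) (h' : IsMonodromy S Φ γ M') :
    M.trace = M'.trace := by
  obtain ⟨C, hC⟩ := hΨ.exists_eq_mul hS hΦ.1
  have hC0 : C.det ≠ 0 := by
    intro h0
    apply hΦ.2
    rw [hC.self_of_nhds, Matrix.det_mul, h0, mul_zero]
  have h1 : S.IsContinuation γ Φ (fun l => Φ l * (C⁻¹ * M * C)) := by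
    refine (IsContinuation.mul_right h C).congr_left hC.symm |>.congr_right ?_
    filter_upwards [hC] with l hl
    rw [hl, mul_assoc (Ψ l) C, ← mul_assoc C, ← mul_assoc C, Matrix.mul_nonsing_inv C hC0.isUnit,
      one_mul, mul_assoc]
  rw [IsMonodromy.eq hΦ.2 h' h1, Matrix.trace_mul_cycle, Matrix.mul_nonsing_inv C hC0.isUnit,
    one_mul]

/-- The trace of the monodromy is invariant under free homotopy of loops. -/
lemma IsMonodromy.trace_eq_of_family (hS : S.Traceless) {J : Type*} [TopologicalSpace J]
    [PreconnectedSpace J] {c : J → PuncturedPlane x} {ω : ∀ s, Path (c s) (c s)}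
    (hω : Continuous fun p : J × I => ω p.1 p.2) {s s' : J}
    (hΨ : S.IsFundamentalNear Ψ (c s)) (hΦ : S.IsFundamentalNear Φ (c s'))
    (h : IsMonodromy S Ψ (ω s) M) (h' : IsMonodromy S Φ (ω s') M') : M.trace = M'.trace := by
  -- The set of all traces attained at s is a singleton, independent of the solution; it is thus a
  -- function of s for which no solution has to be chosen along the moving base point.
  let f : J → Set ℂ := fun s => {τ | ∃ Φ M, S.IsFundamentalNear Φ (c s) ∧
    IsMonodromy S Φ (ω s) M ∧ M.trace = τ}
  have hf : ∀ {s Φ M}, S.IsFundamentalNear Φ (c s) → IsMonodromy S Φ (ω s) M →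
      f s = {M.trace} := by
    intro s Φ M hΦ hM
    ext τ
    constructor
    · rintro ⟨Φ', M', hΦ', hM', rfl⟩
      exact hM'.trace_eq hS hΦ' hΦ hM
    · rintro rfl
      exact ⟨Φ, M, hΦ, hM, rfl⟩
  have hc : Continuous fun s => (c s : ℂ) := by
    have h1 : Continuous fun s => (ω s 0 : ℂ) :=
      continuous_subtype_val.comp (hω.comp (by fun_prop : Continuous fun s : J => (s, (0 : I))))
    simpa using h1
  have hloc : IsLocallyConstant f := by
    rw [IsLocallyConstant.iff_eventually_eq]
    intro s₀
    obtain ⟨V, hVf⟩ := S.exists_isFundamentalNear (c s₀)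
    obtain ⟨M₀, hM₀⟩ := exists_isMonodromy hS hVf (ω s₀)
    obtain ⟨F, hF0, hF⟩ := exists_eventually_continues hS hω s₀ (Φ := V)
      (by simpa using hVf.1)
    simp only [Path.source] at hF0
    have hFf : S.IsFundamentalNear (F 0) (c s₀) := hVf.congr hF0.symm
    have hcont : S.IsContinuation (ω s₀) V (F 1) :=
      ⟨F, hF0, EventuallyEq.rfl, hF.self_of_nhds⟩
    -- An equality of germs at `c s₀` holds as an equality of germs at `c s` for s near `s₀`, so
    -- `M₀` is also a monodromy matrix of the neighbouring loops.
    have hF1 : F 1 =ᶠ[𝓝 (c s₀ : ℂ)] fun l => F 0 l * M₀ := by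
      filter_upwards [hcont.eventuallyEq hM₀, hF0] with l h1 h2
      rw [h1, h2]
    rw [hf hVf hM₀]
    filter_upwards [hF, hc.continuousAt.eventually hFf.eventually,
      hc.continuousAt.eventually (eventually_eventually_nhds.mpr hF1)] with s h1 h2 h3
    exact hf h2 ⟨F, EventuallyEq.rfl, h3, h1⟩
  have h1 := hloc.apply_eq_of_preconnectedSpace s s'
  rw [hf hΨ h, hf hΦ h'] at h1
  exact Set.singleton_injective h1

end Monodromy

end Continuation

/-! ### The trace of the monodromy around one pole and around all poles -/

section CircleTrace

attribute [local instance] Matrix.linftyOpNormedRing Matrix.linftyOpNormedAlgebra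

open FuchsianSystem

variable {x : ℂ} {S : FuchsianSystem x}

/-- The point of the unit circle with angle `2πt`. -/
def circlePoint (t : ℝ) : ℂ := Complex.exp (2 * Real.pi * Complex.I * (t : ℂ))

lemma norm_circlePoint (t : ℝ) : ‖circlePoint t‖ = 1 := by
  rw [circlePoint, Complex.norm_exp]
  simp

lemma circlePoint_zero : circlePoint 0 = 1 := by simp [circlePoint]

lemma circlePoint_one : circlePoint 1 = 1 := by simp [circlePoint, Complex.exp_two_pi_mul_I]

lemma hasDerivAt_circlePoint (t : ℝ) :
    HasDerivAt circlePoint (2 * Real.pi * Complex.I * circlePoint t) t := by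
  have h1 : HasDerivAt (fun t : ℝ => 2 * Real.pi * Complex.I * (t : ℂ))
      (2 * Real.pi * Complex.I * 1) t :=
    (Complex.ofRealCLM.hasDerivAt (x := t)).const_mul _
  refine h1.cexp.congr_deriv ?_
  rw [circlePoint]
  ring

lemma continuous_circlePoint : Continuous circlePoint :=
  continuous_iff_continuousAt.mpr fun t => (hasDerivAt_circlePoint t).continuousAt

/-- Continuation along a circle solves a linear equation in the angle. -/
lemma IsMonodromy.exists_hasDerivWithinAt {c : PuncturedPlane x} {ω : Path c c}
    {Φ : ℂ → Matrix (Fin 2) (Fin 2) ℂ} {M : Matrix (Fin 2) (Fin 2) ℂ} {a r : ℂ}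
    (hω : ∀ t : I, (ω t : ℂ) = a + r * circlePoint t) (h : IsMonodromy S Φ ω M) :
    ∃ Y : ℝ → Matrix (Fin 2) (Fin 2) ℂ, Y 0 = Φ c ∧ Y 1 = Φ c * M ∧
      ContinuousOn Y (Set.Icc 0 1) ∧ ∀ t ∈ Set.Ico (0 : ℝ) 1,
        HasDerivWithinAt Y ((2 * Real.pi * Complex.I * (r * circlePoint t)) •
          (S.coeff (a + r * circlePoint t) * Y t)) (Set.Ici t) t := by
  obtain ⟨F, h0, h1, hF⟩ := h
  let π' : ℝ → I := Set.projIcc 0 1 zero_le_one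
  have hπ : ∀ {t : ℝ} (ht : t ∈ Set.Icc (0 : ℝ) 1), π' t = ⟨t, ht⟩ :=
    fun ht => Set.projIcc_of_mem _ ht
  let g : ℝ → ℂ := fun t => a + r * circlePoint t
  have hg : ∀ {t : ℝ}, t ∈ Set.Icc (0 : ℝ) 1 → (ω (π' t) : ℂ) = g t := by
    intro t ht
    rw [hπ ht, hω]
  have hgd : ∀ t, HasDerivAt g (2 * Real.pi * Complex.I * (r * circlePoint t)) t := by
    intro t
    refine (((hasDerivAt_circlePoint t).const_mul r).const_add a).congr_deriv ?_
    ring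
  have hm0 : (0 : ℝ) ∈ Set.Icc (0 : ℝ) 1 := by simp
  have hm1 : (1 : ℝ) ∈ Set.Icc (0 : ℝ) 1 := by simp
  have e0 : π' 0 = 0 := by simp [π']
  have e1 : π' 1 = 1 := by simp [π']
  have hd : ∀ t ∈ Set.Icc (0 : ℝ) 1, HasDerivWithinAt (fun t => F (π' t) (g t))
      ((2 * Real.pi * Complex.I * (r * circlePoint t)) • (S.coeff (g t) * F (π' t) (g t)))
      (Set.Icc 0 1) t := by
    intro t ht
    have hsol : HasDerivAt (F (π' t)) (S.coeff (g t) * F (π' t) (g t)) (g t) := by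
      have := (hF (π' t)).1.self_of_nhds
      simp only [hg ht] at this
      exact hasDerivAt_matrix_iff.mpr this
    refine ((hsol.scomp t (hgd t)).hasDerivWithinAt (s := Set.Icc 0 1)).congr_of_eventuallyEq
      ?_ rfl
    have h3 : ∀ᶠ s in 𝓝[Set.Icc (0 : ℝ) 1] t, F (π' s) =ᶠ[𝓝 (ω (π' s) : ℂ)] F (π' t) :=
      (continuous_projIcc.continuousAt.eventually (hF (π' t)).2).filter_mono nhdsWithin_le_nhds
    filter_upwards [h3, self_mem_nhdsWithin] with s hs hs1
    have := hs.self_of_nhds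
    rwa [hg hs1] at this
  refine ⟨fun t => F (π' t) (g t), ?_, ?_, fun t ht => (hd t ht).continuousWithinAt,
    fun t ht => ?_⟩
  · dsimp only
    rw [← hg hm0, e0, Path.source]
    exact h0.self_of_nhds
  · dsimp only
    rw [← hg hm1, e1, Path.target]
    exact h1.self_of_nhds
  · refine ((hd t ⟨ht.1, ht.2.le⟩).mono_of_mem_nhdsWithin ?_)
    exact mem_of_superset (Icc_mem_nhdsGE ht.2) (Set.Icc_subset_Icc_left ht.1)

/-- For L² = ρ² the matrix C(t) + i D(t) L is exp(2πi t L). Here D is sin(2πρt)/ρ, whose value for ρ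
= 0 has to be read as the limit 2πt. -/
lemma exists_cos_sin (ρ : ℂ) : ∃ C D : ℝ → ℂ, C 0 = 1 ∧ D 0 = 0 ∧
    C 1 = Complex.cos (2 * Real.pi * ρ) ∧
    (∀ t, HasDerivAt C (-(2 * Real.pi * ρ ^ 2 * D t)) t) ∧
    ∀ t, HasDerivAt D (2 * Real.pi * C t) t := by
  have hlin : ∀ (z : ℂ) (t : ℝ), HasDerivAt (fun t : ℝ => z * (t : ℂ)) z t := by
    intro z t
    simpa using (Complex.ofRealCLM.hasDerivAt (x := t)).const_mul z
  by_cases hρ : ρ = 0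
  · subst hρ
    refine ⟨fun _ => 1, fun t => 2 * Real.pi * t, rfl, by simp, by simp, fun t => ?_, fun t => ?_⟩
    · simpa using hasDerivAt_const t (1 : ℂ)
    · simpa using hlin (2 * Real.pi) t
  · refine ⟨fun t => Complex.cos (2 * Real.pi * ρ * t),
      fun t => Complex.sin (2 * Real.pi * ρ * t) / ρ, by simp, by simp, by simp,
      fun t => ?_, fun t => ?_⟩
    · refine (HasDerivAt.scomp t (Complex.hasDerivAt_cos _)
        (hlin (2 * Real.pi * ρ) t)).congr_deriv ?_
      simp only [smul_eq_mul]
      field_simp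
    · refine ((HasDerivAt.scomp t (Complex.hasDerivAt_sin _)
        (hlin (2 * Real.pi * ρ) t)).div_const ρ).congr_deriv ?_
      simp only [smul_eq_mul]
      field_simp

lemma norm_trace_le (X : Matrix (Fin 2) (Fin 2) ℂ) : ‖X.trace‖ ≤ 2 * ‖X‖ := by
  have h : ∀ i, ‖X i i‖ ≤ ‖X‖ := by
    intro i
    rw [Matrix.linfty_opNorm_def]
    have h1 : ‖X i i‖₊ ≤ ∑ j, ‖X i j‖₊ :=
      Finset.single_le_sum (f := fun j => ‖X i j‖₊) (fun _ _ => zero_le) (Finset.mem_univ i)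
    have h2 := Finset.le_sup (f := fun i => ∑ j, ‖X i j‖₊) (Finset.mem_univ i)
    exact_mod_cast h1.trans h2
  rw [Matrix.trace_fin_two]
  exact (norm_add_le _ _).trans (by linarith [h 0, h 1])

/-- If the equation along a circle is close to one with constant coefficients `2πi L`, then the
trace of the monodromy is close to that of `exp (2πi L)`. -/
lemma exists_norm_trace_sub_le {L : Matrix (Fin 2) (Fin 2) ℂ} {ρ : ℂ} (hL : L.trace = 0)
    (hL2 : L * L = ρ ^ 2 • (1 : Matrix (Fin 2) (Fin 2) ℂ)) :
    ∃ K : ℝ, ∀ (c : PuncturedPlane x) (ω : Path c c) (Φ : ℂ → Matrix (Fin 2) (Fin 2) ℂ)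
      (M : Matrix (Fin 2) (Fin 2) ℂ) (a r : ℂ) (ε : ℝ), ε ≤ 1 →
      (∀ t : I, (ω t : ℂ) = a + r * circlePoint t) → (Φ c).det ≠ 0 → IsMonodromy S Φ ω M →
      (∀ u : ℂ, ‖u‖ = 1 → ‖(r * u) • S.coeff (a + r * u) - L‖ ≤ ε) →
      ‖M.trace - 2 * Complex.cos (2 * Real.pi * ρ)‖ ≤ K * ε := by
  obtain ⟨C, D, hC0, hD0, hC1, hC, hD⟩ := exists_cos_sin ρ
  let E : ℝ → Matrix (Fin 2) (Fin 2) ℂ := fun t => C t • 1 + (Complex.I * D t) • L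
  have hE : ∀ t, HasDerivAt E ((2 * Real.pi * Complex.I) • (L * E t)) t := by
    intro t
    have h1 := ((hC t).smul_const (1 : Matrix (Fin 2) (Fin 2) ℂ)).add
      (((hD t).const_mul Complex.I).smul_const L)
    refine h1.congr_deriv ?_
    simp only [E, mul_add, Matrix.mul_smul, hL2, mul_one, smul_add, smul_smul]
    rw [add_comm]
    congr 1
    · congr 1; ring
    · congr 1; linear_combination (-2 * Real.pi * D t * ρ ^ 2) * Complex.I_sq
  have hEc : ContinuousOn E (Set.Icc 0 1) := fun t _ => (hE t).continuousAt.continuousWithinAt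
  obtain ⟨B, hB⟩ := isCompact_Icc.exists_bound_of_continuousOn hEc
  have hB0 : 0 ≤ B := (norm_nonneg _).trans (hB 0 (by simp))
  have hpi : ‖(2 * Real.pi * Complex.I : ℂ)‖ = 2 * Real.pi := by
    simp [abs_of_pos Real.pi_pos]
  -- For ε ≤ 1 the coefficient is within 2π of 2πi L, so this is a Lipschitz constant independent of
  -- ε; it is nonzero, which selects the exponential form of the Gronwall bound.
  let κ : NNReal := ⟨2 * Real.pi * (‖L‖ + 1), by positivity⟩
  have hκ : (κ : ℝ) ≠ 0 := by
    change 2 * Real.pi * (‖L‖ + 1) ≠ 0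
    positivity
  refine ⟨2 * (2 * Real.pi * B / κ * (Real.exp (κ * 1) - 1)), ?_⟩
  intro c ω Φ M a r ε hε hω hΦ hM hclose
  obtain ⟨Y, hY0, hY1, hYc, hYd⟩ := hM.exists_hasDerivWithinAt hω
  let v : ℝ → Matrix (Fin 2) (Fin 2) ℂ → Matrix (Fin 2) (Fin 2) ℂ := fun t X =>
    (2 * Real.pi * Complex.I * (r * circlePoint t)) • (S.coeff (a + r * circlePoint t) * X)
  have hvdiff : ∀ t X, ‖v t X - (2 * Real.pi * Complex.I) • (L * X)‖
      ≤ 2 * Real.pi * ε * ‖X‖ := by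
    intro t X
    have h1 : v t X - (2 * Real.pi * Complex.I) • (L * X) = (2 * Real.pi * Complex.I) •
        (((r * circlePoint t) • S.coeff (a + r * circlePoint t) - L) * X) := by
      simp only [v, sub_mul, smul_sub, Matrix.smul_mul, smul_smul]
    rw [h1, norm_smul, hpi, mul_assoc (2 * Real.pi) ε]
    refine mul_le_mul_of_nonneg_left ?_ (by positivity)
    exact (norm_mul_le _ _).trans (mul_le_mul_of_nonneg_right (hclose _ (norm_circlePoint t)) (norm_nonneg _))
  have hv : ∀ t, LipschitzWith κ (v t) := by
    intro t
    refine LipschitzWith.of_dist_le_mul fun X X' => ?_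
    rw [dist_eq_norm, dist_eq_norm]
    have h1 : v t X - v t X' = v t (X - X') := by
      simp only [v, mul_sub, smul_sub]
    have h2 : ‖(2 * Real.pi * Complex.I) • (L * (X - X'))‖
        ≤ 2 * Real.pi * (‖L‖ * ‖X - X'‖) := by
      rw [norm_smul, hpi]
      gcongr
      exact norm_mul_le _ _
    have h3 : ‖v t (X - X')‖ ≤ ‖v t (X - X') - (2 * Real.pi * Complex.I) • (L * (X - X'))‖
        + ‖(2 * Real.pi * Complex.I) • (L * (X - X'))‖ := norm_le_norm_sub_add _ _
    have h4 : 2 * Real.pi * ε * ‖X - X'‖ ≤ 2 * Real.pi * 1 * ‖X - X'‖ := by gcongr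
    rw [h1]
    change _ ≤ 2 * Real.pi * (‖L‖ + 1) * ‖X - X'‖
    linarith [hvdiff t (X - X')]
  have hΦu : IsUnit (Φ c).det := hΦ.isUnit
  -- Normalised to start at the identity, the solution ends at a conjugate of M, which has the same
  -- trace.
  have hZ : ∀ t ∈ Set.Ico (0 : ℝ) 1, HasDerivWithinAt (fun t => Y t * (Φ c)⁻¹)
      (v t (Y t * (Φ c)⁻¹)) (Set.Ici t) t := by
    intro t ht
    refine ((hYd t ht).mul_const (Φ c)⁻¹).congr_deriv ?_
    simp only [v, Matrix.smul_mul, mul_assoc]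
  have hE0 : E 0 = 1 := by simp [E, hC0, hD0]
  -- The exact exponential E solves the equation on the circle up to the error 2πεB, where B bounds
  -- E.
  have hdist := dist_le_of_approx_trajectories_ODE (δ := 0) (εf := 0) (εg := 2 * Real.pi * ε * B)
    hv (f := fun t => Y t * (Φ c)⁻¹) (hYc.mul continuousOn_const) hZ (fun t _ => by simp) hEc
    (fun t _ => (hE t).hasDerivWithinAt)
    (fun t ht => by
      rw [dist_comm, dist_eq_norm]
      have hε0 : 0 ≤ ε := (norm_nonneg _).trans (hclose 1 norm_one)
      refine (hvdiff t (E t)).trans ?_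
      gcongr
      exact hB t ⟨ht.1, ht.2.le⟩)
    (by rw [hY0, Matrix.mul_nonsing_inv _ hΦu, hE0, dist_self]) 1 (by simp)
  rw [gronwallBound_of_K_ne_0 hκ, hY1, dist_eq_norm] at hdist
  have hT : M.trace - 2 * Complex.cos (2 * Real.pi * ρ) = (Φ c * M * (Φ c)⁻¹ - E 1).trace := by
    have h1 : (E 1).trace = 2 * Complex.cos (2 * Real.pi * ρ) := by
      simp only [E, Matrix.trace_add, Matrix.trace_smul, hL, hC1, Matrix.trace_one,
        Fintype.card_fin]
      simp
      ring
    have h2 : (Φ c * M * (Φ c)⁻¹).trace = M.trace := by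
      rw [Matrix.trace_mul_cycle, Matrix.nonsing_inv_mul _ hΦu, one_mul]
    rw [Matrix.trace_sub, h1, h2]
  rw [hT]
  refine (norm_trace_le _).trans ?_
  have h5 : ‖Φ c * M * (Φ c)⁻¹ - E 1‖
      ≤ 2 * Real.pi * B / κ * (Real.exp (κ * 1) - 1) * ε := by
    refine hdist.trans (le_of_eq ?_)
    simp only [sub_zero, zero_mul, zero_add]
    ring
  calc _ ≤ 2 * (2 * Real.pi * B / κ * (Real.exp (κ * 1) - 1) * ε) := by gcongr
    _ = _ := by ring

/-- The circle with centre `a` and radius `r`, as a loop avoiding the poles. -/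
def circlePath (a r : ℂ) (h : ∀ u : ℂ, ‖u‖ = 1 → a + r * u ≠ 0 ∧ a + r * u ≠ x ∧ a + r * u ≠ 1) :
    Path (⟨a + r * 1, h 1 norm_one⟩ : PuncturedPlane x) ⟨a + r * 1, h 1 norm_one⟩ where
  toFun t := ⟨a + r * circlePoint t, h _ (norm_circlePoint t)⟩
  continuous_toFun := by
    refine Continuous.subtype_mk ?_ _
    exact continuous_const.add (continuous_const.mul
      (continuous_circlePoint.comp continuous_subtype_val))
  source' := by simp [circlePoint_zero]
  target' := by simp [circlePoint_one]

/-- If, in a connected family of concentric circles, the equation comes arbitrarily close to one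
with constant coefficients `2πi L`, then the trace of the monodromy is that of `exp (2πi L)`. -/
lemma IsMonodromy.trace_circle (hS : S.Traceless) {L : Matrix (Fin 2) (Fin 2) ℂ} {ρ : ℂ}
    (hL : L.trace = 0) (hL2 : L * L = ρ ^ 2 • (1 : Matrix (Fin 2) (Fin 2) ℂ))
    {a r : ℂ} {J : Set ℝ} (hJ : IsPreconnected J) (h1J : (1 : ℝ) ∈ J)
    (hav : ∀ s ∈ J, ∀ u : ℂ, ‖u‖ = 1 →
      a + s * r * u ≠ 0 ∧ a + s * r * u ≠ x ∧ a + s * r * u ≠ 1)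
    (hlim : ∀ ε > 0, ∃ s ∈ J, ∀ u : ℂ, ‖u‖ = 1 →
      ‖(s * r * u) • S.coeff (a + s * r * u) - L‖ ≤ ε)
    {c : PuncturedPlane x} {ω : Path c c} (hω : ∀ t : I, (ω t : ℂ) = a + r * circlePoint t)
    {Φ : ℂ → Matrix (Fin 2) (Fin 2) ℂ} {M : Matrix (Fin 2) (Fin 2) ℂ}
    (hΦ : S.IsFundamentalNear Φ c) (hM : IsMonodromy S Φ ω M) :
    M.trace = 2 * Complex.cos (2 * Real.pi * ρ) := by
  have : PreconnectedSpace J := isPreconnected_iff_preconnectedSpace.mp hJ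
  obtain ⟨K, hK⟩ := exists_norm_trace_sub_le (x := x) (S := S) hL hL2
  let c' : J → PuncturedPlane x := fun s => ⟨a + s * r * 1, hav s s.2 1 norm_one⟩
  let ω' : ∀ s : J, Path (c' s) (c' s) := fun s => circlePath (x := x) a (s * r) (hav s s.2)
  have hω' : Continuous fun p : J × I => ω' p.1 p.2 := by
    refine Continuous.subtype_mk ?_ _
    refine continuous_const.add (Continuous.mul ?_ ?_)
    · exact (Complex.continuous_ofReal.comp (continuous_subtype_val.comp continuous_fst)).mul
        continuous_const
    · exact continuous_circlePoint.comp (continuous_subtype_val.comp continuous_snd)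
  obtain rfl : c = c' ⟨1, h1J⟩ := by
    apply Subtype.ext
    have := hω 0
    rw [Path.source] at this
    simpa [circlePoint_zero, c'] using this
  have hω1 : ω = ω' ⟨1, h1J⟩ := by
    ext t
    rw [hω]
    simp [ω', circlePath]
  rw [hω1] at hM
  -- The trace is the same on all circles of the family, so it may be estimated on the one where the
  -- equation is ε-close to constant coefficients.
  have hle : ∀ ε > 0, ε ≤ 1 → ‖M.trace - 2 * Complex.cos (2 * Real.pi * ρ)‖ ≤ K * ε := by
    intro ε hε hε1
    obtain ⟨s, hs, hclose⟩ := hlim ε hε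
    obtain ⟨V, hVf⟩ := S.exists_isFundamentalNear (c' ⟨s, hs⟩)
    obtain ⟨M', hM'⟩ := exists_isMonodromy hS hVf (ω' ⟨s, hs⟩)
    rw [IsMonodromy.trace_eq_of_family (c := c') (ω := ω') (s := ⟨1, h1J⟩) (s' := ⟨s, hs⟩)
      hS hω' hΦ hVf hM hM']
    exact hK _ _ V M' a (s * r) ε hε1 (fun t => rfl) hVf.2 hM' hclose
  have hlim0 : Tendsto (fun ε : ℝ => K * ε) (𝓝[>] 0) (𝓝 (K * 0)) :=
    ((continuous_const.mul continuous_id).tendsto 0).mono_left nhdsWithin_le_nhds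
  have h0 : ‖M.trace - 2 * Complex.cos (2 * Real.pi * ρ)‖ ≤ K * 0 := by
    refine ge_of_tendsto hlim0 ?_
    filter_upwards [Ioc_mem_nhdsGT (zero_lt_one (α := ℝ))] with ε hε using hle ε hε.1 hε.2
  rw [mul_zero] at h0
  exact sub_eq_zero.mp (norm_le_zero_iff.mp h0)

end CircleTrace

/-! ### Small circles, large circles and the resulting traces. -/

section LoopTrace

attribute [local instance] Matrix.linftyOpNormedRing Matrix.linftyOpNormedAlgebra

open FuchsianSystem

variable {x : ℂ} {S : FuchsianSystem x}

/-- Cayley–Hamilton for a traceless matrix. -/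
lemma mul_self_of_trace_eq_zero {L : Matrix (Fin 2) (Fin 2) ℂ} {ρ : ℂ} (hL : L.trace = 0)
    (hd : L.det = -ρ ^ 2) : L * L = ρ ^ 2 • (1 : Matrix (Fin 2) (Fin 2) ℂ) := by
  rw [Matrix.trace_fin_two] at hL
  rw [Matrix.det_fin_two] at hd
  ext i j
  fin_cases i <;> fin_cases j <;> simp [Matrix.mul_apply, Fin.sum_univ_two]
  · linear_combination L 0 0 * hL - hd
  · linear_combination L 0 1 * hL
  · linear_combination L 1 0 * hL
  · linear_combination L 1 1 * hL - hd

/-- Near a pole only the residue at this pole contributes. -/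
lemma eventually_norm_div_sub_le_of_pole (a p : ℂ) {r : ℂ} (hr : r ≠ 0) {ε : ℝ} (hε : 0 < ε) :
    ∀ᶠ s : ℝ in 𝓝[>] 0, ∀ u : ℂ, ‖u‖ = 1 →
      ‖s * r * u / (a + s * r * u - p) - if p = a then 1 else 0‖ ≤ ε := by
  split_ifs with hpa
  · subst hpa
    filter_upwards [self_mem_nhdsWithin] with s hs u hu
    have hs0 : (s : ℂ) ≠ 0 := Complex.ofReal_ne_zero.mpr (ne_of_gt hs)
    have hu0 : u ≠ 0 := norm_ne_zero_iff.mp (by rw [hu]; exact one_ne_zero)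
    rw [add_sub_cancel_left, div_self (mul_ne_zero (mul_ne_zero hs0 hr) hu0), sub_self, norm_zero]
    exact hε.le
  · have hd : 0 < ‖p - a‖ := norm_pos_iff.mpr (sub_ne_zero.mpr hpa)
    have hlim : Tendsto (fun s : ℝ => s * ‖r‖) (𝓝[>] 0) (𝓝 (0 * ‖r‖)) :=
      ((continuous_id.mul continuous_const).tendsto 0).mono_left nhdsWithin_le_nhds
    rw [zero_mul] at hlim
    filter_upwards [self_mem_nhdsWithin, hlim.eventually_le_const (half_pos hd),
      hlim.eventually_le_const (by positivity : 0 < ε * (‖p - a‖ / 2))] with s hs h1 h2 u hu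
    have hn : ‖(s : ℂ) * r * u‖ = s * ‖r‖ := by
      rw [norm_mul, norm_mul, hu, Complex.norm_real, Real.norm_of_nonneg (le_of_lt hs), mul_one]
    have h3 : ‖p - a‖ / 2 ≤ ‖a + s * r * u - p‖ := by
      have h4 : ‖p - a‖ ≤ ‖a + s * r * u - p‖ + ‖(s : ℂ) * r * u‖ := by
        have h5 : p - a = -(a + s * r * u - p) + s * r * u := by ring
        calc ‖p - a‖ = ‖-(a + s * r * u - p) + s * r * u‖ := by rw [← h5]
          _ ≤ _ := (norm_add_le _ _).trans (by rw [norm_neg])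
      linarith
    rw [sub_zero, norm_div, hn, div_le_iff₀ (by linarith)]
    exact h2.trans (by gcongr)

/-- Near infinity all residues contribute. -/
lemma eventually_norm_div_sub_le_of_infty (a p : ℂ) {r : ℂ} (hr : r ≠ 0) {ε : ℝ} (hε : 0 < ε) :
    ∀ᶠ s : ℝ in atTop, ∀ u : ℂ, ‖u‖ = 1 →
      ‖s * r * u / (a + s * r * u - p) - 1‖ ≤ ε := by
  have hlim : Tendsto (fun s : ℝ => s * ‖r‖) atTop atTop :=
    tendsto_id.atTop_mul_const (norm_pos_iff.mpr hr)
  -- One ‖p - a‖ is lost in the triangle inequality, ‖p - a‖/ε gives the estimate, and 1 keeps the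
  -- denominator nonzero.
  filter_upwards [hlim.eventually_ge_atTop (‖p - a‖ + ‖p - a‖ / ε + 1), eventually_ge_atTop 0]
    with s h1 hs u hu
  have hn : ‖(s : ℂ) * r * u‖ = s * ‖r‖ := by
    rw [norm_mul, norm_mul, hu, Complex.norm_real, Real.norm_of_nonneg hs, mul_one]
  have h3 : ‖p - a‖ / ε + 1 ≤ ‖a + s * r * u - p‖ := by
    have h4 : ‖(s : ℂ) * r * u‖ ≤ ‖a + s * r * u - p‖ + ‖p - a‖ := by
      calc ‖(s : ℂ) * r * u‖ = ‖(a + s * r * u - p) + (p - a)‖ := by ring_nf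
        _ ≤ _ := norm_add_le _ _
    linarith
  have h0 : 0 ≤ ‖p - a‖ / ε := by positivity
  have hne : a + s * r * u - p ≠ 0 := norm_pos_iff.mp (by linarith)
  rw [div_sub_one hne]
  have h5 : s * r * u - (a + s * r * u - p) = p - a := by ring
  rw [h5, norm_div, div_le_iff₀ (by linarith)]
  calc ‖p - a‖ = ε * (‖p - a‖ / ε) := by field_simp
    _ ≤ ε * ‖a + s * r * u - p‖ := by gcongr; linarith

lemma norm_smul_coeff_sub_le (S : FuchsianSystem x) {w l e0 ex e1 : ℂ} {ε : ℝ}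
    (h0 : ‖w / (l - 0) - e0‖ ≤ ε) (hx : ‖w / (l - x) - ex‖ ≤ ε) (h1 : ‖w / (l - 1) - e1‖ ≤ ε) :
    ‖w • S.coeff l - (e0 • S.A0 + ex • S.Ax + e1 • S.A1)‖
      ≤ ε * (‖S.A0‖ + ‖S.Ax‖ + ‖S.A1‖) := by
  have h : w • S.coeff l - (e0 • S.A0 + ex • S.Ax + e1 • S.A1) =
      (w / (l - 0) - e0) • S.A0 + (w / (l - x) - ex) • S.Ax + (w / (l - 1) - e1) • S.A1 := by
    simp only [FuchsianSystem.coeff, sub_zero, smul_add, smul_smul, sub_smul, mul_one_div]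
    abel
  rw [h]
  refine norm_add₃_le.trans ?_
  rw [norm_smul, norm_smul, norm_smul, mul_add, mul_add]
  gcongr

lemma exists_norm_smul_coeff_sub_le (S : FuchsianSystem x) {a r e0 ex e1 : ℂ} {J : Set ℝ}
    {l : Filter ℝ} [l.NeBot] (hJ : ∀ᶠ s in l, s ∈ J)
    (h0 : ∀ ε > 0, ∀ᶠ s : ℝ in l, ∀ u : ℂ, ‖u‖ = 1 →
      ‖s * r * u / (a + s * r * u - 0) - e0‖ ≤ ε)
    (hx : ∀ ε > 0, ∀ᶠ s : ℝ in l, ∀ u : ℂ, ‖u‖ = 1 →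
      ‖s * r * u / (a + s * r * u - x) - ex‖ ≤ ε)
    (h1 : ∀ ε > 0, ∀ᶠ s : ℝ in l, ∀ u : ℂ, ‖u‖ = 1 →
      ‖s * r * u / (a + s * r * u - 1) - e1‖ ≤ ε) {ε : ℝ} (hε : 0 < ε) :
    ∃ s ∈ J, ∀ u : ℂ, ‖u‖ = 1 →
      ‖(s * r * u) • S.coeff (a + s * r * u) - (e0 • S.A0 + ex • S.Ax + e1 • S.A1)‖ ≤ ε := by
  set B := ‖S.A0‖ + ‖S.Ax‖ + ‖S.A1‖ with hB
  have hB0 : 0 ≤ B := by positivity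
  have hε' : 0 < ε / (B + 1) := by positivity
  obtain ⟨s, hs, g0, gx, g1⟩ :=
    (hJ.and ((h0 _ hε').and ((hx _ hε').and (h1 _ hε')))).exists
  refine ⟨s, hs, fun u hu => (norm_smul_coeff_sub_le S (g0 u hu) (gx u hu) (g1 u hu)).trans ?_⟩
  rw [← hB, div_mul_eq_mul_div, div_le_iff₀ (by linarith)]
  gcongr
  linarith

/-- The trace of the monodromy along a loop around a circle is that along the circle. -/
lemma IsMonodromy.trace_of_isConjCircle (hS : S.Traceless) {b : PuncturedPlane x}
    {Ψ : ℂ → Matrix (Fin 2) (Fin 2) ℂ} {γ : Path b b} {M : Matrix (Fin 2) (Fin 2) ℂ} {a r τ : ℂ}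
    (hΨ : S.IsFundamentalNear Ψ b) (hM : IsMonodromy S Ψ γ M) (hγ : IsConjCircle a r γ)
    (h : ∀ (c : PuncturedPlane x) (ω : Path c c) (Φ : ℂ → Matrix (Fin 2) (Fin 2) ℂ)
      (M : Matrix (Fin 2) (Fin 2) ℂ), (∀ t : I, (ω t : ℂ) = a + r * circlePoint t) →
      S.IsFundamentalNear Φ c → IsMonodromy S Φ ω M → M.trace = τ) : M.trace = τ := by
  obtain ⟨c, δ, ω, hω, hh⟩ := hγ
  obtain ⟨Φ, hδ⟩ := exists_isContinuation hS δ hΨ.1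
  have hΦ := hδ.isFundamentalNear hS hΨ
  obtain ⟨M', hM'⟩ := exists_isMonodromy hS hΦ ω
  rw [hM.eq hΨ.2 ((hM'.conj hδ).of_homotopic hS hh.symm)]
  exact h c ω Φ M' hω hΦ hM'

/-- The trace of the monodromy around a pole is determined by the residue. -/
lemma IsMonodromy.trace_of_isLoopAround (hS : S.Traceless) {b : PuncturedPlane x}
    {Ψ : ℂ → Matrix (Fin 2) (Fin 2) ℂ} {γ : Path b b} {M L : Matrix (Fin 2) (Fin 2) ℂ} {a ρ : ℂ}
    (hΨ : S.IsFundamentalNear Ψ b) (hM : IsMonodromy S Ψ γ M) (hγ : IsLoopAround a γ)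
    (hL : (if 0 = a then (1 : ℂ) else 0) • S.A0 + (if x = a then (1 : ℂ) else 0) • S.Ax
      + (if 1 = a then (1 : ℂ) else 0) • S.A1 = L)
    (hL1 : L.trace = 0) (hL2 : L.det = -ρ ^ 2) :
    M.trace = 2 * Complex.cos (2 * Real.pi * ρ) := by
  obtain ⟨r, hr, hfar, hγ⟩ := hγ
  refine hM.trace_of_isConjCircle hS hΨ hγ fun c ω Φ M' hω hΦ hM' => ?_
  -- Circles shrinking towards a stay free of poles since every other pole is farther from a than
  -- ‖r‖.
  have hav : ∀ p ∈ ({0, x, 1} : Set ℂ), ∀ s ∈ Set.Ioc (0 : ℝ) 1, ∀ u : ℂ, ‖u‖ = 1 →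
      a + s * r * u ≠ p := by
    intro p hp s hs u hu he
    have hpa : p - a = s * r * u := by rw [← he]; ring
    have hn : ‖p - a‖ = s * ‖r‖ := by
      rw [hpa, norm_mul, norm_mul, hu, Complex.norm_real, Real.norm_of_nonneg hs.1.le, mul_one]
    have hr0 : 0 < ‖r‖ := norm_pos_iff.mpr hr
    by_cases h : p = a
    · rw [h, sub_self, norm_zero] at hn
      exact (mul_pos hs.1 hr0).ne hn
    · have := hfar p hp h
      rw [hn] at this
      nlinarith [hs.2]
  refine hM'.trace_circle hS hL1 (mul_self_of_trace_eq_zero hL1 hL2)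
    (isPreconnected_Ioc (a := (0 : ℝ)) (b := 1)) (by simp)
    (fun s hs u hu => ⟨hav 0 (by simp) s hs u hu, hav x (by simp) s hs u hu,
      hav 1 (by simp) s hs u hu⟩) (fun ε hε => ?_) hω hΦ
  rw [← hL]
  exact exists_norm_smul_coeff_sub_le S (l := 𝓝[>] (0 : ℝ)) (Ioc_mem_nhdsGT zero_lt_one)
    (fun ε hε => eventually_norm_div_sub_le_of_pole a 0 hr hε)
    (fun ε hε => eventually_norm_div_sub_le_of_pole a x hr hε)
    (fun ε hε => eventually_norm_div_sub_le_of_pole a 1 hr hε) hε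

/-- The trace of the monodromy around all poles is determined by the residue at infinity. -/
lemma IsMonodromy.trace_of_isLoopAroundAll (hS : S.Traceless) {b : PuncturedPlane x}
    {Ψ : ℂ → Matrix (Fin 2) (Fin 2) ℂ} {γ : Path b b} {M : Matrix (Fin 2) (Fin 2) ℂ} {ρ : ℂ}
    (hΨ : S.IsFundamentalNear Ψ b) (hM : IsMonodromy S Ψ γ M) (hγ : IsLoopAroundAll γ)
    (hL2 : (S.A0 + S.Ax + S.A1).det = -ρ ^ 2) :
    M.trace = 2 * Complex.cos (2 * Real.pi * ρ) := by
  obtain ⟨a, r, hfar, hγ⟩ := hγ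
  have hr : r ≠ 0 := norm_pos_iff.mp ((norm_nonneg _).trans_lt (hfar 0 (by simp)))
  refine hM.trace_of_isConjCircle hS hΨ hγ fun c ω Φ M' hω hΦ hM' => ?_
  -- Growing circles stay free of poles since all poles already lie inside the first one.
  have hav : ∀ p ∈ ({0, x, 1} : Set ℂ), ∀ s ∈ Set.Ici (1 : ℝ), ∀ u : ℂ, ‖u‖ = 1 →
      a + s * r * u ≠ p := by
    intro p hp s hs u hu he
    have hs1 : 1 ≤ s := hs
    have hpa : p - a = s * r * u := by rw [← he]; ring
    have hn : ‖p - a‖ = s * ‖r‖ := by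
      rw [hpa, norm_mul, norm_mul, hu, Complex.norm_real, Real.norm_of_nonneg (by linarith),
        mul_one]
    have := hfar p hp
    rw [hn] at this
    nlinarith [norm_nonneg r]
  have hL1 : (S.A0 + S.Ax + S.A1).trace = 0 := by
    simp [Matrix.trace_add, hS.A0, hS.Ax, hS.A1]
  refine hM'.trace_circle hS hL1 (mul_self_of_trace_eq_zero hL1 hL2)
    (isPreconnected_Ici (a := (1 : ℝ))) (by simp)
    (fun s hs u hu => ⟨hav 0 (by simp) s hs u hu, hav x (by simp) s hs u hu,
      hav 1 (by simp) s hs u hu⟩) (fun ε hε => ?_) hω hΦ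
  have h := exists_norm_smul_coeff_sub_le S (J := Set.Ici 1) (l := (atTop : Filter ℝ)) (Ici_mem_atTop 1)
    (fun ε hε => eventually_norm_div_sub_le_of_infty a 0 hr hε)
    (fun ε hε => eventually_norm_div_sub_le_of_infty a x hr hε)
    (fun ε hε => eventually_norm_div_sub_le_of_infty a 1 hr hε) hε
  simpa only [one_smul] using h

end LoopTrace

/-! ### Loops under affine changes of variable -/

section Loops

variable {x x' : ℂ}

/-- The class of a loop in the fundamental group. -/
abbrev loopClass {X : Type*} [TopologicalSpace X] {b : X} (γ : Path b b) : FundamentalGroup X b :=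
  FundamentalGroup.fromPath (Path.Homotopic.Quotient.mk γ)

lemma loopClass_trans {X : Type*} [TopologicalSpace X] {b : X} (γ γ' : Path b b) :
    loopClass (γ.trans γ') = loopClass γ' * loopClass γ :=
  rfl

lemma loopClass_symm {X : Type*} [TopologicalSpace X] {b : X} (γ : Path b b) :
    loopClass γ.symm = (loopClass γ)⁻¹ :=
  rfl

lemma loopClass_eq_iff {X : Type*} [TopologicalSpace X] {b : X} {γ γ' : Path b b} :
    loopClass γ = loopClass γ' ↔ γ.Homotopic γ' :=
  Path.Homotopic.Quotient.eq

section

variable {b : PuncturedPlane x} {a r : ℂ} {γ γ' : Path b b}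

lemma IsConjCircle.of_homotopic (h : IsConjCircle a r γ) (hγ : γ'.Homotopic γ) :
    IsConjCircle a r γ' := by
  obtain ⟨c, δ, ω, hω, hh⟩ := h
  exact ⟨c, δ, ω, hω, hγ.trans hh⟩

lemma IsLoopAround.of_homotopic (h : IsLoopAround a γ) (hγ : γ'.Homotopic γ) :
    IsLoopAround a γ' := by
  obtain ⟨r, hr, hf, hc⟩ := h
  exact ⟨r, hr, hf, hc.of_homotopic hγ⟩

lemma IsLoopAroundAll.of_homotopic (h : IsLoopAroundAll γ) (hγ : γ'.Homotopic γ) :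
    IsLoopAroundAll γ' := by
  obtain ⟨a, r, hf, hc⟩ := h
  exact ⟨a, r, hf, hc.of_homotopic hγ⟩

lemma IsConjCircle.conj (h : IsConjCircle a r γ) (η : Path b b) :
    IsConjCircle a r ((η.trans γ).trans η.symm) := by
  obtain ⟨c, δ, ω, hω, hh⟩ := h
  refine ⟨c, η.trans δ, ω, hω, ?_⟩
  rw [← Path.Homotopic.Quotient.eq] at hh ⊢
  simp only [Path.Homotopic.Quotient.mk_trans, Path.trans_symm, hh,
    Path.Homotopic.Quotient.trans_assoc]

lemma IsLoopAround.conj (h : IsLoopAround a γ) (η : Path b b) :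
    IsLoopAround a ((η.trans γ).trans η.symm) := by
  obtain ⟨r, hr, hf, hc⟩ := h
  exact ⟨r, hr, hf, hc.conj η⟩

end

/-- `f` is the restriction of `l ↦ α l + β`, with inverse `h`, and permutes the poles. -/
structure IsAffineChange (f : C(PuncturedPlane x, PuncturedPlane x')) (h : ℂ → ℂ)
    (α β : ℂ) : Prop where
  ne_zero : α ≠ 0
  apply : ∀ l, (f l : ℂ) = α * l + β
  inverse : ∀ l, α * h l + β = l
  poles : ∀ p ∈ ({0, x, 1} : Set ℂ), α * p + β ∈ ({0, x', 1} : Set ℂ)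
  poles_inverse : ∀ p ∈ ({0, x', 1} : Set ℂ), h p ∈ ({0, x, 1} : Set ℂ)

namespace IsAffineChange

variable {f : C(PuncturedPlane x, PuncturedPlane x')} {h : ℂ → ℂ} {α β : ℂ}
  {b : PuncturedPlane x} {γ : Path b b} {a r : ℂ}

lemma isConjCircle (hf : IsAffineChange f h α β) (hγ : IsConjCircle a r γ) :
    IsConjCircle (α * a + β) (α * r) (γ.map f.continuous) := by
  obtain ⟨c, δ, ω, hω, hh⟩ := hγ
  refine ⟨f c, δ.map f.continuous, ω.map f.continuous, fun t => ?_, ?_⟩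
  · rw [Path.map_coe, Function.comp_apply, hf.apply, hω]
    ring
  · have h1 := hh.map f
    rwa [Path.map_trans, Path.map_trans] at h1

lemma norm_sub (hf : IsAffineChange f h α β) (p a : ℂ) :
    ‖p - (α * a + β)‖ = ‖α‖ * ‖h p - a‖ := by
  rw [← norm_mul]
  congr 1
  linear_combination -hf.inverse p

lemma isLoopAround (hf : IsAffineChange f h α β) (hγ : IsLoopAround a γ) :
    IsLoopAround (α * a + β) (γ.map f.continuous) := by
  obtain ⟨r, hr, hfar, hc⟩ := hγ
  refine ⟨α * r, mul_ne_zero hf.ne_zero hr, fun p hp hpa => ?_, hf.isConjCircle hc⟩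
  rw [norm_mul, hf.norm_sub]
  have h1 : h p ≠ a := by
    rintro rfl
    exact hpa (hf.inverse p).symm
  exact mul_lt_mul_of_pos_left (hfar _ (hf.poles_inverse p hp) h1)
    (norm_pos_iff.mpr hf.ne_zero)

lemma isLoopAroundAll (hf : IsAffineChange f h α β) (hγ : IsLoopAroundAll γ) :
    IsLoopAroundAll (γ.map f.continuous) := by
  obtain ⟨a, r, hfar, hc⟩ := hγ
  refine ⟨α * a + β, α * r, fun p hp => ?_, hf.isConjCircle hc⟩
  rw [norm_mul, hf.norm_sub]
  exact mul_lt_mul_of_pos_left (hfar _ (hf.poles_inverse p hp)) (norm_pos_iff.mpr hf.ne_zero)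

lemma inverse_apply (hf : IsAffineChange f h α β) (l : PuncturedPlane x) : h (f l) = l := by
  have h1 := hf.inverse (f l)
  rw [hf.apply l] at h1 ⊢
  exact mul_left_cancel₀ hf.ne_zero (add_right_cancel h1)

lemma inverse_eq (hf : IsAffineChange f h α β) : h = fun l => α⁻¹ * (l - β) := by
  funext l
  rw [eq_inv_mul_iff_mul_eq₀ hf.ne_zero]
  linear_combination hf.inverse l

lemma continuous_inverse (hf : IsAffineChange f h α β) : Continuous h := by
  rw [hf.inverse_eq]
  fun_prop

lemma inverse_mem (hf : IsAffineChange f h α β) (l : PuncturedPlane x') :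
    h l ≠ 0 ∧ h l ≠ x ∧ h l ≠ 1 := by
  have key : h l ∉ ({0, x, 1} : Set ℂ) := by
    intro hl
    have h1 := hf.poles _ hl
    rw [hf.inverse] at h1
    have h2 := l.2
    simp only [Set.mem_insert_iff, Set.mem_singleton_iff] at h1
    tauto
  simpa [not_or] using key

lemma surjective_map (hf : IsAffineChange f h α β) (b : PuncturedPlane x) :
    Function.Surjective (FundamentalGroup.map f b) := by
  intro p
  obtain ⟨γ', rfl⟩ : ∃ γ' : Path (f b) (f b), p = loopClass γ' := by
    obtain ⟨γ', hγ'⟩ := Path.Homotopic.Quotient.mk_surjective p.toPath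
    exact ⟨γ', hγ'.symm⟩
  -- A loop in the target is lifted pointwise by the inverse affine map.
  let γ : Path b b :=
    { toFun := fun t => ⟨h (γ' t), hf.inverse_mem (γ' t)⟩
      continuous_toFun := Continuous.subtype_mk
        (hf.continuous_inverse.comp (continuous_subtype_val.comp γ'.continuous)) _
      source' := by
        apply Subtype.ext
        simp only [Path.source]
        exact hf.inverse_apply b
      target' := by
        apply Subtype.ext
        simp only [Path.target]
        exact hf.inverse_apply b }
  have hγ : γ.map f.continuous = γ' := by
    ext t
    rw [Path.map_coe, Function.comp_apply, hf.apply]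
    exact hf.inverse _
  refine ⟨loopClass γ, ?_⟩
  rw [← hγ]
  rfl

lemma closure_eq_top (hf : IsAffineChange f h α β) {γ₁ γ₂ γ₃ : Path b b}
    (hγ : Subgroup.closure ({loopClass γ₁, loopClass γ₂, loopClass γ₃} :
      Set (FundamentalGroup (PuncturedPlane x) b)) = ⊤) :
    Subgroup.closure ({loopClass (γ₁.map f.continuous), loopClass (γ₂.map f.continuous),
      loopClass (γ₃.map f.continuous)} :
        Set (FundamentalGroup (PuncturedPlane x') (f b))) = ⊤ := by
  have h1 := congrArg (Subgroup.map (FundamentalGroup.map f b)) hγ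
  rw [MonoidHom.map_closure, Subgroup.map_top_of_surjective _ (hf.surjective_map b),
    Set.image_insert_eq, Set.image_pair] at h1
  exact h1

end IsAffineChange

lemma closure_eq_top_of_mem {G : Type*} [Group G] {s t : Set G} (hs : Subgroup.closure s = ⊤)
    (h : ∀ g ∈ s, g ∈ Subgroup.closure t) : Subgroup.closure t = ⊤ :=
  top_le_iff.mp (hs ▸ (Subgroup.closure_le _).mpr h)

/-- The braid `(t₀, t₁, t_x) ↦ (t₀, t₁ t_x t₁⁻¹, t₁)` of an ordered basis. -/
lemma isOrderedBasis_of_conj_right {b : PuncturedPlane x} {t0 t1 tx g0 gx g1 : Path b b}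
    (h0 : IsLoopAround 0 t0) (h1 : IsLoopAround 1 t1) (hx : IsLoopAround x tx)
    (hall : IsLoopAroundAll ((t0.trans t1).trans tx))
    (hgen : Subgroup.closure ({loopClass t0, loopClass t1, loopClass tx} :
      Set (FundamentalGroup (PuncturedPlane x) b)) = ⊤)
    (e0 : g0.Homotopic t0) (ex : gx.Homotopic ((t1.trans tx).trans t1.symm))
    (e1 : g1.Homotopic t1) : IsOrderedBasis g0 gx g1 := by
  have f0 := loopClass_eq_iff.mpr e0
  have fx := loopClass_eq_iff.mpr ex
  have f1 := loopClass_eq_iff.mpr e1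
  simp only [loopClass_trans, loopClass_symm] at fx
  refine ⟨h0.of_homotopic e0, (hx.conj t1).of_homotopic ex, h1.of_homotopic e1,
    hall.of_homotopic (loopClass_eq_iff.mp ?_), closure_eq_top_of_mem hgen ?_⟩
  -- The new product t₀ · t₁tₓt₁⁻¹ · t₁ telescopes to the old product t₀t₁tₓ.
  · simp only [loopClass_trans, f0, fx, f1]
    group
  · set C := Subgroup.closure ({loopClass g0, loopClass gx, loopClass g1} :
      Set (FundamentalGroup (PuncturedPlane x) b))
    have m0 : loopClass g0 ∈ C := Subgroup.subset_closure (by simp)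
    have mx : loopClass gx ∈ C := Subgroup.subset_closure (by simp)
    have m1 : loopClass g1 ∈ C := Subgroup.subset_closure (by simp)
    rw [f0] at m0
    rw [f1] at m1
    have mx' : loopClass tx ∈ C := by
      -- The conjugation looks inverted because classes multiply in the order opposite to
      -- concatenation.
      have h2 : loopClass tx = loopClass t1 * loopClass gx * (loopClass t1)⁻¹ := by
        rw [fx]
        group
      rw [h2]
      exact C.mul_mem (C.mul_mem m1 mx) (C.inv_mem m1)
    rintro g (rfl | rfl | rfl)
    exacts [m0, m1, mx']

/-- The braid `(t₁, t_x, t₀) ↦ (t₀, t₀⁻¹ t_x t₀, t₀⁻¹ t_x⁻¹ t₁ t_x t₀)` of an ordered basis. -/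
lemma isOrderedBasis_of_conj_left {b : PuncturedPlane x} {t0 t1 tx g0 gx g1 : Path b b}
    (h0 : IsLoopAround 0 t0) (h1 : IsLoopAround 1 t1) (hx : IsLoopAround x tx)
    (hall : IsLoopAroundAll ((t1.trans tx).trans t0))
    (hgen : Subgroup.closure ({loopClass t1, loopClass tx, loopClass t0} :
      Set (FundamentalGroup (PuncturedPlane x) b)) = ⊤)
    (e0 : g0.Homotopic t0) (ex : gx.Homotopic ((t0.symm.trans tx).trans t0))
    (e1 : g1.Homotopic ((((t0.symm.trans tx.symm).trans t1).trans tx).trans t0)) :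
    IsOrderedBasis g0 gx g1 := by
  have f0 := loopClass_eq_iff.mpr e0
  have fx := loopClass_eq_iff.mpr ex
  have f1 := loopClass_eq_iff.mpr e1
  simp only [loopClass_trans, loopClass_symm] at fx f1
  refine ⟨h0.of_homotopic e0, (hx.conj t0.symm).of_homotopic (by rwa [Path.symm_symm]),
    (h1.conj (t0.symm.trans tx.symm)).of_homotopic (loopClass_eq_iff.mp ?_),
    hall.of_homotopic (loopClass_eq_iff.mp ?_), closure_eq_top_of_mem hgen ?_⟩
  · simp only [loopClass_trans, loopClass_symm, f1]
    group
  -- The new product t₀ · t₀⁻¹tₓt₀ · t₀⁻¹tₓ⁻¹t₁tₓt₀ telescopes to t₁tₓt₀.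
  · simp only [loopClass_trans, f0, fx, f1]
    group
  · set C := Subgroup.closure ({loopClass g0, loopClass gx, loopClass g1} :
      Set (FundamentalGroup (PuncturedPlane x) b))
    have m0 : loopClass g0 ∈ C := Subgroup.subset_closure (by simp)
    have mx : loopClass gx ∈ C := Subgroup.subset_closure (by simp)
    have m1 : loopClass g1 ∈ C := Subgroup.subset_closure (by simp)
    rw [f0] at m0
    have mx' : loopClass tx ∈ C := by
      have h2 : loopClass tx = (loopClass t0)⁻¹ * loopClass gx * loopClass t0 := by
        rw [fx]
        group
      rw [h2]
      exact C.mul_mem (C.mul_mem (C.inv_mem m0) mx) m0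
    have m1' : loopClass t1 ∈ C := by
      have h2 : loopClass t1 = (loopClass tx)⁻¹ * (loopClass t0)⁻¹ * loopClass g1 * loopClass t0
          * loopClass tx := by
        rw [f1]
        group
      rw [h2]
      exact C.mul_mem (C.mul_mem (C.mul_mem (C.mul_mem (C.inv_mem mx') (C.inv_mem m0)) m1) m0) mx'
    rintro g (rfl | rfl | rfl)
    exacts [m1', mx', m0]

end Loops

/-! ### Solutions under affine changes of variable and constant gauges -/

section Transport

open FuchsianSystem

attribute [local instance] Matrix.linftyOpNormedRing Matrix.linftyOpNormedAlgebra

variable {x x' : ℂ} {S : FuchsianSystem x} {S' : FuchsianSystem x'}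
  {Φ Φ' : ℂ → Matrix (Fin 2) (Fin 2) ℂ}

/-- `hG` says that the two connections correspond under the substitution h and the constant gauge G;
the chain rule does the rest. -/
lemma FuchsianSystem.IsSolutionNear.comp {h : ℂ → ℂ} {c : ℂ} {G : Matrix (Fin 2) (Fin 2) ℂ}
    (hh : ∀ l, HasDerivAt h c l) (hG : ∀ l, S'.coeff l * G = c • (G * S.coeff (h l))) {z : ℂ}
    (hΦ : S.IsSolutionNear Φ (h z)) : S'.IsSolutionNear (fun l => G * Φ (h l)) z := by
  filter_upwards [(hh z).continuousAt.eventually hΦ] with w hw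
  rw [← hasDerivAt_matrix_iff (Φ := fun l => G * Φ (h l))]
  have h1 := ((hasDerivAt_matrix_iff.mpr hw).scomp w (hh w)).const_mul G
  refine h1.congr_deriv ?_
  rw [← mul_assoc, hG, Matrix.mul_smul, Matrix.smul_mul, mul_assoc]

lemma FuchsianSystem.coeff_mul_inverse {h f : ℂ → ℂ} {c : ℂ} {G H : Matrix (Fin 2) (Fin 2) ℂ}
    (hc : c ≠ 0) (hG : ∀ l, S'.coeff l * G = c • (G * S.coeff (h l))) (hhf : ∀ l, h (f l) = l)
    (hHG : H * G = 1) (l : ℂ) : S.coeff l * H = c⁻¹ • (H * S'.coeff (f l)) := by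
  have hGH : G * H = 1 := mul_eq_one_comm.mp hHG
  have h1 := congrArg (fun X => c⁻¹ • (H * X * H)) (hG (f l))
  simp only [hhf, mul_assoc, hGH, mul_one, Matrix.mul_smul, Matrix.smul_mul, smul_smul,
    inv_mul_cancel₀ hc, one_smul] at h1
  rw [h1, ← mul_assoc, hHG, one_mul]

lemma FuchsianSystem.isFundamentalNear_comp_iff {h f : ℂ → ℂ} {c : ℂ}
    {G H : Matrix (Fin 2) (Fin 2) ℂ} (hc : c ≠ 0) (hh : ∀ l, HasDerivAt h c l)
    (hf : ∀ l, HasDerivAt f c⁻¹ l) (hG : ∀ l, S'.coeff l * G = c • (G * S.coeff (h l)))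
    (hhf : ∀ l, h (f l) = l) (hHG : H * G = 1) {z : ℂ} :
    S.IsFundamentalNear Φ z ↔ S'.IsFundamentalNear (fun l => G * Φ (h l)) (f z) := by
  have hdet : G.det ≠ 0 := by
    intro h0
    have := congrArg Matrix.det hHG
    rw [Matrix.det_mul, h0, mul_zero, Matrix.det_one] at this
    exact zero_ne_one this
  constructor
  · rintro ⟨h1, h2⟩
    refine ⟨IsSolutionNear.comp hh hG (by rwa [hhf]), ?_⟩
    dsimp only
    rw [Matrix.det_mul, hhf]
    exact mul_ne_zero hdet h2
  · rintro ⟨h1, h2⟩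
    dsimp only at h2
    rw [Matrix.det_mul, hhf] at h2
    refine ⟨?_, right_ne_zero_of_mul h2⟩
    have h3 := IsSolutionNear.comp hf (coeff_mul_inverse hc hG hhf hHG) h1
    simpa only [hhf, ← mul_assoc, hHG, one_mul] using h3

/-- Each germ of the continuation is substituted and multiplied by G on the left, while M acts on
the right and so is unaffected. -/
lemma IsMonodromy.map {h : ℂ → ℂ} {c : ℂ} {G : Matrix (Fin 2) (Fin 2) ℂ}
    (hh : ∀ l, HasDerivAt h c l) (hG : ∀ l, S'.coeff l * G = c • (G * S.coeff (h l)))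
    {f : C(PuncturedPlane x, PuncturedPlane x')} (hhf : ∀ l, h (f l) = l)
    {b : PuncturedPlane x} {γ : Path b b} {M : Matrix (Fin 2) (Fin 2) ℂ}
    (hM : IsMonodromy S Φ γ M) :
    IsMonodromy S' (fun l => G * Φ (h l)) (γ.map f.continuous) M := by
  obtain ⟨F, h0, h1, hF⟩ := hM
  have key : ∀ (l : PuncturedPlane x) {Θ Θ' : ℂ → Matrix (Fin 2) (Fin 2) ℂ},
      Θ =ᶠ[𝓝 (l : ℂ)] Θ' →
        (fun w => G * Θ (h w)) =ᶠ[𝓝 (f l : ℂ)] fun w => G * Θ' (h w) := by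
    intro l Θ Θ' he
    rw [← hhf l] at he
    filter_upwards [(hh (f l)).continuousAt.eventually he] with w hw
    rw [hw]
  refine ⟨fun t l => G * F t (h l), key b h0, ?_, fun t => ⟨?_, ?_⟩⟩
  · have := key b h1
    simpa only [mul_assoc] using this
  · refine IsSolutionNear.comp hh hG ?_
    rw [Path.map_coe, Function.comp_apply, hhf]
    exact (hF t).1
  · exact (hF t).2.mono fun s hs => key (γ s) hs

end Transport

/-! ### Traces of products of unimodular matrices -/

section Traces

/-- With B⁻¹ = tr(B) - B the left side is tr(B)tr(CBA) - tr(AB·CB). The same identity for the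
adjugate of CB, together with B·adj(B) = 1, gives tr(AB·CB) = tr(AB)tr(CB) - tr(A)tr(C) + tr(AC). -/
lemma trace_mul_inv_mul_mul {A B C : Matrix (Fin 2) (Fin 2) ℂ} (hB : B.det = 1) :
    (A * (B⁻¹ * C * B)).trace = B.trace * (C * B * A).trace - (A * B).trace * (C * B).trace
      + A.trace * C.trace - (A * C).trace := by
  rw [Matrix.inv_def, hB, Ring.inverse_one, one_smul]
  rw [Matrix.det_fin_two] at hB
  simp only [Matrix.trace_fin_two, Matrix.mul_apply, Fin.sum_univ_two, Matrix.adjugate_fin_two,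
    Matrix.of_apply, Matrix.cons_val', Matrix.cons_val_zero, Matrix.cons_val_one]
  linear_combination ((A 0 0 + A 1 1) * (C 0 0 + C 1 1) - (A 0 0 * C 0 0 + A 0 1 * C 1 0
    + (A 1 0 * C 0 1 + A 1 1 * C 1 1))) * hB

end Traces

/-! ### The two symmetries for the associated system. -/

section Symmetries

open FuchsianSystem

variable {θ : Theta} {U : Set ℂ} {y k k' : ℂ → ℂ} {x : ℂ}

lemma assocSystem_traceless (θ : Theta) (y k : ℂ → ℂ) (x : ℂ) :
    (assocSystem θ y k x).Traceless :=
  ⟨(jmuSystem_trace _ _ _ _ _).1, (jmuSystem_trace _ _ _ _ _).2.1,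
    (jmuSystem_trace _ _ _ _ _).2.2⟩

/-- The traces of the monodromy matrices of the associated system. -/
lemma monodromy_traces (hθ : θ.tinf ≠ 0) (hy : IsPVISolution θ U y) (hk : IsGaugeFactor θ U y k)
    (hxU : x ∈ U) {b : PuncturedPlane x} {γ0 γx γ1 : Path b b} (hγ : IsOrderedBasis γ0 γx γ1)
    {Ψ : ℂ → Matrix (Fin 2) (Fin 2) ℂ} (hΨ : (assocSystem θ y k x).IsFundamentalNear Ψ b)
    {M0 Mx M1 : Matrix (Fin 2) (Fin 2) ℂ} (hM0 : IsMonodromy (assocSystem θ y k x) Ψ γ0 M0)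
    (hMx : IsMonodromy (assocSystem θ y k x) Ψ γx Mx)
    (hM1 : IsMonodromy (assocSystem θ y k x) Ψ γ1 M1) :
    M0.trace = 2 * Complex.cos (Real.pi * θ.t0) ∧ Mx.trace = 2 * Complex.cos (Real.pi * θ.tx) ∧
      M1.trace = 2 * Complex.cos (Real.pi * θ.t1) ∧
      (M1 * Mx * M0).trace = 2 * Complex.cos (Real.pi * θ.tinf) := by
  obtain ⟨hx0, hx1, hy0, hy1, hyx, -⟩ := hy.2.2 x hxU
  have hS := assocSystem_traceless θ y k x
  obtain ⟨d0, dx, d1⟩ := jmuSystem_det θ (p := deriv y x) hx0 hx1 hy0 hy1 hyx (hk x hxU).1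
  have hsum := jmuSystem_sum θ hθ (p := deriv y x) hx0 hx1 hy0 hy1 hyx (hk x hxU).1
  -- The eigenvalues are ±θ/2, so the angle 2πρ is πθ.
  have hcos : ∀ t : ℂ, (2 * Real.pi * (t / 2) : ℂ) = Real.pi * t := fun t => by ring
  refine ⟨?_, ?_, ?_, ?_⟩
  · rw [← hcos]
    exact hM0.trace_of_isLoopAround hS hΨ hγ.around_zero (by simp [hx0]) hS.A0 d0
  · rw [← hcos]
    exact hMx.trace_of_isLoopAround hS hΨ hγ.around_x (by simp [hx0.symm, hx1.symm]) hS.Ax dx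
  · rw [← hcos]
    exact hM1.trace_of_isLoopAround hS hΨ hγ.around_one (by simp [hx1]) hS.A1 d1
  · rw [← hcos, mul_assoc]
    refine ((hM0.trans hMx).trans hM1).trace_of_isLoopAroundAll hS hΨ hγ.around_all ?_
    change ((jmuSystem θ x (y x) (deriv y x) (k x)).A0 + (jmuSystem θ x (y x) (deriv y x) (k x)).Ax
      + (jmuSystem θ x (y x) (deriv y x) (k x)).A1).det = _
    rw [hsum, Matrix.det_fin_two_of]
    ring

lemma IsMonodromy.iff_eq {S : FuchsianSystem x} {b : PuncturedPlane x}
    {Ψ : ℂ → Matrix (Fin 2) (Fin 2) ℂ} {γ : Path b b} {M : Matrix (Fin 2) (Fin 2) ℂ}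
    (hΨ : S.IsFundamentalNear Ψ b) (hM : IsMonodromy S Ψ γ M) (N : Matrix (Fin 2) (Fin 2) ℂ) :
    IsMonodromy S Ψ γ N ↔ N = M :=
  ⟨fun h => h.eq hΨ.2 hM, fun h => h ▸ hM⟩

lemma assocSystem_sigma3 (hy : IsPVISolution θ U y) (hxU : x ∈ U) :
    assocSystem (sigma3Theta θ) (sigma3Fun y) k' x⁻¹
      = jmuSystem (sigma3Theta θ) x⁻¹ (1 / x * y x) (y x - x * deriv y x) (k' x⁻¹) := by
  have h0 : (0 : ℂ) ∉ U := fun h0 => (hy.2.2 0 h0).1 rfl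
  rw [assocSystem, deriv_sigma3Fun hy.1 h0 hy.2.1 (by rwa [inv_inv])]
  simp only [sigma3Fun, inv_inv]

lemma assocSystem_sigma1 (hy : IsPVISolution θ U y) (hxU : x ∈ U) :
    assocSystem (sigma1Theta θ) (sigma1Fun y) k' (1 - x)
      = jmuSystem (sigma1Theta θ) (1 - x) (1 - y x) (deriv y x) (k' (1 - x)) := by
  rw [assocSystem, deriv_sigma1Fun hy.1 hy.2.1 (by rwa [sub_sub_cancel])]
  simp only [sigma1Fun, sub_sub_cancel]

lemma isAffineChange_sigma3Map (hx : x ≠ 0) :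
    IsAffineChange (sigma3Map hx) (fun l => x * l) x⁻¹ 0 where
  ne_zero := inv_ne_zero hx
  apply l := by
    change (l : ℂ) / x = _
    field_simp
    ring
  inverse l := by
    field_simp
    ring
  poles := by
    rintro p (rfl | rfl | rfl) <;> simp [hx]
  poles_inverse := by
    rintro p (rfl | rfl | rfl) <;> simp [hx]

lemma isAffineChange_sigma1Map (x : ℂ) :
    IsAffineChange (sigma1Map x) (fun l => 1 - l) (-1) 1 where
  ne_zero := neg_ne_zero.mpr one_ne_zero
  apply l := by
    change 1 - (l : ℂ) = _
    ring
  inverse l := by ring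
  poles := by
    rintro p (rfl | rfl | rfl)
    · simp
    · right; left; ring
    · simp
  poles_inverse := by
    rintro p (rfl | rfl | rfl) <;> simp

/-- The logarithmic derivatives of k'(1/u) and k(u) are (θ_∞-1)(y-1)/(u(u-1)) and
(θ_∞-1)(y-u)/(u(u-1)); y cancels in their difference. -/
lemma hasDerivAt_sigma3_gauge_div (hy : IsPVISolution θ U y) (hk : IsGaugeFactor θ U y k)
    (hk' : IsGaugeFactor (sigma3Theta θ) {x' | x'⁻¹ ∈ U} (sigma3Fun y) k') {u : ℂ} (hu : u ∈ U) :
    HasDerivAt (fun v => k' v⁻¹ / k v) ((θ.tinf - 1) / u * (k' u⁻¹ / k u)) u := by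
  obtain ⟨hu0, hu1, -⟩ := hy.2.2 u hu
  obtain ⟨hk0, hkd⟩ := hk u hu
  obtain ⟨-, hkd'⟩ := hk' u⁻¹ (by simpa using hu)
  have e3 : u - 1 ≠ 0 := sub_ne_zero.mpr hu1
  have f1 : u⁻¹ - 1 = -(u - 1) / u := by field_simp; ring
  refine ((hkd'.comp u (hasDerivAt_inv hu0)).div hkd hk0).congr_deriv ?_
  simp only [Function.comp, sigma3Fun, sigma3Theta, inv_inv, f1]
  field_simp
  ring

/-- The (1,2) residues sum to zero, so over the common denominator the numerator is linear in l,
with the single zero y/x. -/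
lemma jmuSystem_coeff_sigma3 {p κ : ℂ} {v l : ℂ} (hx0 : x ≠ 0) (hx1 : x ≠ 1) (hκ : κ ≠ 0)
    (h0 : l ≠ 0) (hx : l ≠ x⁻¹) (h1 : l ≠ 1) :
    (⟨(jmuSystem θ x v p κ).A0, (jmuSystem θ x v p κ).A1, (jmuSystem θ x v p κ).Ax⟩ :
      FuchsianSystem x⁻¹).coeff l 0 1 = 0 ↔ l = 1 / x * v := by
  have e3 : x - 1 ≠ 0 := sub_ne_zero.mpr hx1
  have e1 : l - 1 ≠ 0 := sub_ne_zero.mpr h1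
  have e2 : x * l - 1 ≠ 0 := by
    intro h
    apply hx
    field_simp
    linear_combination h
  obtain ⟨d, hd⟩ : ∃ d, x * l - 1 = d := ⟨_, rfl⟩
  have f1 : l - x⁻¹ = d / x := by
    rw [← hd]
    field_simp
  rw [hd] at e2
  have key : (⟨(jmuSystem θ x v p κ).A0, (jmuSystem θ x v p κ).A1, (jmuSystem θ x v p κ).Ax⟩ :
      FuchsianSystem x⁻¹).coeff l 0 1
        = κ / (l * d * (l - 1)) * (l - 1 / x * v) := by
    simp [FuchsianSystem.coeff, jmuSystem_eq, residueSystem, f1]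
    field_simp
    rw [← hd]
    ring
  rw [key, mul_eq_zero, sub_eq_zero]
  simp [hκ, h0, e1, e2]

lemma jmuSystem_coeff_sigma1 {p κ : ℂ} {v l : ℂ} (hx0 : x ≠ 0) (hx1 : x ≠ 1) (hκ : κ ≠ 0)
    (h0 : l ≠ 0) (hx : l ≠ 1 - x) (h1 : l ≠ 1) :
    (⟨(jmuSystem θ x v p κ).A1, (jmuSystem θ x v p κ).Ax, (jmuSystem θ x v p κ).A0⟩ :
      FuchsianSystem (1 - x)).coeff l 0 1 = 0 ↔ l = 1 - v := by
  have e3 : x - 1 ≠ 0 := sub_ne_zero.mpr hx1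
  have e1 : l - 1 ≠ 0 := sub_ne_zero.mpr h1
  have e2 : l - (1 - x) ≠ 0 := sub_ne_zero.mpr hx
  have key : (⟨(jmuSystem θ x v p κ).A1, (jmuSystem θ x v p κ).Ax, (jmuSystem θ x v p κ).A0⟩ :
      FuchsianSystem (1 - x)).coeff l 0 1
        = -κ / (l * (l - (1 - x)) * (l - 1)) * (l - (1 - v)) := by
    simp [FuchsianSystem.coeff, jmuSystem_eq, residueSystem]
    field_simp
    ring
  rw [key, mul_eq_zero, sub_eq_zero]
  simp [hκ, h0, e1, e2]

lemma coeff_mul_gauge_sigma3 {S : FuchsianSystem x} {S' : FuchsianSystem x⁻¹}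
    {K : Matrix (Fin 2) (Fin 2) ℂ} (hx0 : x ≠ 0) (hK : K * K⁻¹ = 1)
    (h : S'.A0 = K⁻¹ * S.A0 * K ∧ S'.Ax = K⁻¹ * S.A1 * K ∧ S'.A1 = K⁻¹ * S.Ax * K) (l : ℂ) :
    S'.coeff l * K⁻¹ = x • (K⁻¹ * S.coeff (x * l)) := by
  -- Also true at w = 0, where both sides are 0 by convention; hence the gauge relation needs no
  -- exclusion of poles.
  have hw : ∀ w : ℂ, x * (1 / (x * w)) = 1 / w := fun w => by
    rw [one_div, one_div, mul_inv, mul_inv_cancel_left₀ hx0]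
  have e1 : x * l - x = x * (l - 1) := by ring
  have ex : x * l - 1 = x * (l - x⁻¹) := by rw [mul_sub, mul_inv_cancel₀ hx0]
  simp only [FuchsianSystem.coeff, h.1, h.2.1, h.2.2, add_mul, mul_add, Matrix.smul_mul,
    Matrix.mul_smul, smul_add, smul_smul, mul_assoc, hK, mul_one, e1, ex, hw]
  abel

lemma coeff_mul_gauge_sigma1 {S : FuchsianSystem x} {S' : FuchsianSystem (1 - x)}
    {K : Matrix (Fin 2) (Fin 2) ℂ} (hK : K * K⁻¹ = 1)
    (h : S'.A0 = K⁻¹ * S.A1 * K ∧ S'.Ax = K⁻¹ * S.Ax * K ∧ S'.A1 = K⁻¹ * S.A0 * K) (l : ℂ) :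
    S'.coeff l * K⁻¹ = (-1 : ℂ) • (K⁻¹ * S.coeff (1 - l)) := by
  have hw : ∀ w : ℂ, -1 * (1 / (-w)) = 1 / w := fun w => by
    rw [one_div, one_div, inv_neg, neg_mul_neg, one_mul]
  have e0 : 1 - l = -(l - 1) := by ring
  have e1 : 1 - l - 1 = -l := by ring
  have ex : 1 - l - x = -(l - (1 - x)) := by ring
  simp only [FuchsianSystem.coeff, h.1, h.2.1, h.2.2, add_mul, mul_add, Matrix.smul_mul,
    Matrix.mul_smul, smul_add, smul_smul, mul_assoc, hK, mul_one, e1, ex, hw]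
  rw [e0, hw]
  abel

end Symmetries

end

/-! ### Assembly of the two symmetries. -/

theorem mainTheorem6 (θ : Theta) (hθ : θ.tinf ≠ 0) (U : Set ℂ) (y k : ℂ → ℂ)
    (hy : IsPVISolution θ U y) (hk : IsGaugeFactor θ U y k)
    (x : ℂ) (hxU : x ∈ U) (hx0 : x ≠ 0)
    (b : PuncturedPlane x) (γ0 γx γ1 : Path b b) (hγ : IsOrderedBasis γ0 γx γ1)
    (Ψ : ℂ → Matrix (Fin 2) (Fin 2) ℂ)
    (hΨ : (assocSystem θ y k x).IsFundamentalNear Ψ b)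
    (M0 Mx M1 : Matrix (Fin 2) (Fin 2) ℂ)
    (hM0 : IsMonodromy (assocSystem θ y k x) Ψ γ0 M0)
    (hMx : IsMonodromy (assocSystem θ y k x) Ψ γx Mx)
    (hM1 : IsMonodromy (assocSystem θ y k x) Ψ γ1 M1) :
    -- the symmetry σ³
    (IsPVISolution (sigma3Theta θ) {x' | x'⁻¹ ∈ U} (sigma3Fun y) ∧
      ∀ k' : ℂ → ℂ, IsGaugeFactor (sigma3Theta θ) {x' | x'⁻¹ ∈ U} (sigma3Fun y) k' →
      ∀ S : FuchsianSystem x, S = assocSystem θ y k x →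
      ∀ S' : FuchsianSystem x⁻¹, S' = assocSystem (sigma3Theta θ) (sigma3Fun y) k' x⁻¹ →
      ∀ K : Matrix (Fin 2) (Fin 2) ℂ, K = sigma3Gauge x (k x) (k' x⁻¹) →
        -- the gauge factor `k'` is a constant multiple of `k x ^ (θ_∞ - 1)`
        (∀ u ∈ U, HasDerivAt (fun v => k' v⁻¹ / k v) ((θ.tinf - 1) / u * (k' u⁻¹ / k u)) u) ∧
        -- diagonal gauge and change of variable
        (S'.A0 = K⁻¹ * S.A0 * K ∧ S'.Ax = K⁻¹ * S.A1 * K ∧ S'.A1 = K⁻¹ * S.Ax * K) ∧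
        (∀ (Φ : ℂ → Matrix (Fin 2) (Fin 2) ℂ) (l : PuncturedPlane x),
          S.IsFundamentalNear Φ l ↔
            S'.IsFundamentalNear (fun l' => K⁻¹ * Φ (x * l')) (sigma3Map hx0 l)) ∧
        (∀ l' : PuncturedPlane x⁻¹,
          (⟨S.A0, S.A1, S.Ax⟩ : FuchsianSystem x⁻¹).coeff l' 0 1 = 0 ↔
            (l' : ℂ) = sigma3Fun y x⁻¹) ∧
        -- change of the basis of loops, monodromy matrices and traces
        ∀ t0 tx t1 : Path (sigma3Map hx0 b) (sigma3Map hx0 b),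
          t0 = γ0.map (sigma3Map hx0).continuous →
          t1 = γx.map (sigma3Map hx0).continuous →
          tx = γ1.map (sigma3Map hx0).continuous →
          ∀ g0 gx g1 : Path (sigma3Map hx0 b) (sigma3Map hx0 b),
            g0.Homotopic t0 → gx.Homotopic ((t1.trans tx).trans t1.symm) → g1.Homotopic t1 →
            IsOrderedBasis g0 gx g1 ∧
            (∀ N, IsMonodromy S' (fun l' => K⁻¹ * Ψ (x * l')) g0 N ↔ N = M0) ∧
            (∀ N, IsMonodromy S' (fun l' => K⁻¹ * Ψ (x * l')) gx N ↔ N = Mx⁻¹ * M1 * Mx) ∧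
            (∀ N, IsMonodromy S' (fun l' => K⁻¹ * Ψ (x * l')) g1 N ↔ N = Mx) ∧
            ∀ N0 Nx N1 : Matrix (Fin 2) (Fin 2) ℂ,
              IsMonodromy S' (fun l' => K⁻¹ * Ψ (x * l')) g0 N0 →
              IsMonodromy S' (fun l' => K⁻¹ * Ψ (x * l')) gx Nx →
              IsMonodromy S' (fun l' => K⁻¹ * Ψ (x * l')) g1 N1 →
              (N0 * Nx).trace = -(M0 * M1).trace - (M0 * Mx).trace * (M1 * Mx).trace
                + 4 * (Complex.cos (Real.pi * θ.tinf) * Complex.cos (Real.pi * θ.tx)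
                  + Complex.cos (Real.pi * θ.t0) * Complex.cos (Real.pi * θ.t1)) ∧
              (N0 * N1).trace = (M0 * Mx).trace ∧
              (N1 * Nx).trace = (M1 * Mx).trace) ∧
    -- the symmetry σ¹
    (IsPVISolution (sigma1Theta θ) {x' | 1 - x' ∈ U} (sigma1Fun y) ∧
      ∀ k' : ℂ → ℂ, IsGaugeFactor (sigma1Theta θ) {x' | 1 - x' ∈ U} (sigma1Fun y) k' →
      ∀ S : FuchsianSystem x, S = assocSystem θ y k x →
      ∀ S' : FuchsianSystem (1 - x),
        S' = assocSystem (sigma1Theta θ) (sigma1Fun y) k' (1 - x) →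
      ∀ K : Matrix (Fin 2) (Fin 2) ℂ, K = sigma1Gauge (k x) (k' (1 - x)) →
        -- diagonal gauge and change of variable
        (S'.A0 = K⁻¹ * S.A1 * K ∧ S'.Ax = K⁻¹ * S.Ax * K ∧ S'.A1 = K⁻¹ * S.A0 * K) ∧
        (∀ (Φ : ℂ → Matrix (Fin 2) (Fin 2) ℂ) (l : PuncturedPlane x),
          S.IsFundamentalNear Φ l ↔
            S'.IsFundamentalNear (fun l' => K⁻¹ * Φ (1 - l')) (sigma1Map x l)) ∧
        (∀ l' : PuncturedPlane (1 - x),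
          (⟨S.A1, S.Ax, S.A0⟩ : FuchsianSystem (1 - x)).coeff l' 0 1 = 0 ↔
            (l' : ℂ) = sigma1Fun y (1 - x)) ∧
        -- change of the basis of loops, monodromy matrices and traces
        ∀ t0 tx t1 : Path (sigma1Map x b) (sigma1Map x b),
          t1 = γ0.map (sigma1Map x).continuous →
          tx = γx.map (sigma1Map x).continuous →
          t0 = γ1.map (sigma1Map x).continuous →
          ∀ g0 gx g1 : Path (sigma1Map x b) (sigma1Map x b),
            g0.Homotopic t0 → gx.Homotopic ((t0.symm.trans tx).trans t0) →
            g1.Homotopic ((((t0.symm.trans tx.symm).trans t1).trans tx).trans t0) →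
            IsOrderedBasis g0 gx g1 ∧
            (∀ N, IsMonodromy S' (fun l' => K⁻¹ * Ψ (1 - l')) g0 N ↔ N = M1) ∧
            (∀ N, IsMonodromy S' (fun l' => K⁻¹ * Ψ (1 - l')) gx N ↔ N = M1 * Mx * M1⁻¹) ∧
            (∀ N, IsMonodromy S' (fun l' => K⁻¹ * Ψ (1 - l')) g1 N ↔
              N = M1 * Mx * M0 * Mx⁻¹ * M1⁻¹) ∧
            ∀ N0 Nx N1 : Matrix (Fin 2) (Fin 2) ℂ,
              IsMonodromy S' (fun l' => K⁻¹ * Ψ (1 - l')) g0 N0 →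
              IsMonodromy S' (fun l' => K⁻¹ * Ψ (1 - l')) gx Nx →
              IsMonodromy S' (fun l' => K⁻¹ * Ψ (1 - l')) g1 N1 →
              (N0 * Nx).trace = (M1 * Mx).trace ∧
              (N0 * N1).trace = -(M0 * M1).trace - (M1 * Mx).trace * (M0 * Mx).trace
                + 4 * (Complex.cos (Real.pi * θ.tinf) * Complex.cos (Real.pi * θ.tx)
                  + Complex.cos (Real.pi * θ.t1) * Complex.cos (Real.pi * θ.t0)) ∧
              (N1 * Nx).trace = (M0 * Mx).trace) := by
  obtain ⟨-, hx1, hy0, hy1, hyx, -⟩ := hy.2.2 x hxU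
  have hk0 := (hk x hxU).1
  have hSt := assocSystem_traceless θ y k x
  obtain ⟨τ0, τx, τ1, τinf⟩ := monodromy_traces hθ hy hk hxU hγ hΨ hM0 hMx hM1
  have hdx := hMx.det hSt hΨ.2
  have hd1 := hM1.det hSt hΨ.2
  -- In this arrangement C B A is M₁ Mₓ M₀, the monodromy around all poles. The identity serves both
  -- symmetries.
  have htrace := trace_mul_inv_mul_mul (A := M0) (C := M1) hdx
  rw [τ0, τx, τ1, τinf] at htrace
  refine ⟨⟨hy.sigma3, ?_⟩, ⟨hy.sigma1, ?_⟩⟩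
  · intro k' hk' S hS S' hS' K hK
    have hk0' : k' x⁻¹ ≠ 0 := (hk' x⁻¹ (by simpa using hxU)).1
    have hSt' : S'.Traceless := hS' ▸ assocSystem_traceless _ _ _ _
    rw [assocSystem_sigma3 hy hxU] at hS'
    have hres := jmuSystem_sigma3 θ hθ (p := deriv y x) hx0 hx1 hy0 hy1 hyx hk0 hk0'
    dsimp only at hres
    rw [← hS', ← hK] at hres
    change S = jmuSystem θ x (y x) (deriv y x) (k x) at hS
    rw [← hS] at hres
    rw [assocSystem, ← hS] at hΨ hM0 hMx hM1
    have hKu : IsUnit K.det := by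
      rw [hK, sigma3Gauge, Matrix.det_fin_two_of]
      simp [hk0, hx0, hk0']
    have hcoeff := coeff_mul_gauge_sigma3 hx0 (Matrix.mul_nonsing_inv K hKu) hres
    have hinv : ∀ l, HasDerivAt (fun l : ℂ => x * l) x l := fun l => by
      simpa using (hasDerivAt_id l).const_mul x
    have hfor : ∀ l, HasDerivAt (fun l : ℂ => l / x) x⁻¹ l := fun l => by
      simpa using (hasDerivAt_id l).div_const x
    have hff : ∀ l : ℂ, x * (l / x) = l := fun l => by field_simp
    have hiff : ∀ (Φ : ℂ → Matrix (Fin 2) (Fin 2) ℂ) (l : PuncturedPlane x),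
        S.IsFundamentalNear Φ l ↔
          S'.IsFundamentalNear (fun l' => K⁻¹ * Φ (x * l')) (sigma3Map hx0 l) := fun Φ l =>
      FuchsianSystem.isFundamentalNear_comp_iff hx0 hinv hfor hcoeff hff
        (Matrix.mul_nonsing_inv K hKu)
    refine ⟨fun u hu => hasDerivAt_sigma3_gauge_div hy hk hk' hu, hres, hiff, fun l' => ?_, ?_⟩
    · rw [hS, sigma3Fun, inv_inv]
      exact jmuSystem_coeff_sigma3 hx0 hx1 hk0 l'.2.1 l'.2.2.1 l'.2.2.2
    · intro t0 tx t1 ht0 ht1 htx g0 gx g1 e0 ex e1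
      have hΨ' := (hiff Ψ b).mp hΨ
      have haff := isAffineChange_sigma3Map hx0
      have hhf : ∀ l : PuncturedPlane x, x * (sigma3Map hx0 l : ℂ) = l := haff.inverse_apply
      have n0 := hM0.map hinv hcoeff hhf
      have n1 := hMx.map hinv hcoeff hhf
      have nx := hM1.map hinv hcoeff hhf
      rw [← ht0] at n0
      rw [← ht1] at n1
      rw [← htx] at nx
      have m0 := n0.of_homotopic hSt' e0.symm
      have m1 := n1.of_homotopic hSt' e1.symm
      have mx := ((n1.trans nx).trans (n1.symm (hdx ▸ one_ne_zero))).of_homotopic hSt' ex.symm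
      rw [← mul_assoc] at mx
      have b0 := haff.isLoopAround hγ.around_zero
      have b1 := haff.isLoopAround hγ.around_x
      have bx := haff.isLoopAround hγ.around_one
      have ball := haff.isLoopAroundAll hγ.around_all
      have bgen := haff.closure_eq_top hγ.generate
      rw [Path.map_trans, Path.map_trans] at ball
      rw [← ht0, ← ht1, ← htx] at ball bgen
      rw [← ht0, mul_zero, add_zero] at b0
      rw [← ht1, inv_mul_cancel₀ hx0, add_zero] at b1
      rw [← htx, mul_one, add_zero] at bx
      refine ⟨isOrderedBasis_of_conj_right b0 b1 bx ball bgen e0 ex e1, m0.iff_eq hΨ',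
        mx.iff_eq hΨ', m1.iff_eq hΨ', fun N0 Nx N1 h0 hx h1 => ?_⟩
      rw [(m0.iff_eq hΨ' N0).mp h0, (mx.iff_eq hΨ' Nx).mp hx, (m1.iff_eq hΨ' N1).mp h1]
      refine ⟨by rw [htrace]; ring, rfl, ?_⟩
      rw [← mul_assoc, ← mul_assoc, Matrix.mul_nonsing_inv Mx (hdx ▸ isUnit_one), one_mul]
  · intro k' hk' S hS S' hS' K hK
    have hk0' : k' (1 - x) ≠ 0 := (hk' (1 - x) (by simpa using hxU)).1
    have hSt' : S'.Traceless := hS' ▸ assocSystem_traceless _ _ _ _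
    rw [assocSystem_sigma1 hy hxU] at hS'
    have hres := jmuSystem_sigma1 θ hθ (p := deriv y x) hx0 hx1 hy0 hy1 hyx hk0 hk0'
    dsimp only at hres
    rw [← hS', ← hK] at hres
    change S = jmuSystem θ x (y x) (deriv y x) (k x) at hS
    rw [← hS] at hres
    rw [assocSystem, ← hS] at hΨ hM0 hMx hM1
    have hKu : IsUnit K.det := by
      rw [hK, sigma1Gauge, Matrix.det_fin_two_of]
      simp [hk0, hk0']
    have hcoeff := coeff_mul_gauge_sigma1 (Matrix.mul_nonsing_inv K hKu) hres
    have hinv : ∀ l, HasDerivAt (fun l : ℂ => 1 - l) (-1) l := fun l =>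
      (hasDerivAt_id l).const_sub 1
    have hiff : ∀ (Φ : ℂ → Matrix (Fin 2) (Fin 2) ℂ) (l : PuncturedPlane x),
        S.IsFundamentalNear Φ l ↔
          S'.IsFundamentalNear (fun l' => K⁻¹ * Φ (1 - l')) (sigma1Map x l) := fun Φ l =>
      FuchsianSystem.isFundamentalNear_comp_iff (f := fun l => 1 - l)
        (neg_ne_zero.mpr one_ne_zero) hinv (by rw [inv_neg, inv_one]; exact hinv) hcoeff
        (fun l => sub_sub_cancel 1 l) (Matrix.mul_nonsing_inv K hKu)
    refine ⟨hres, hiff, fun l' => ?_, ?_⟩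
    · rw [hS, sigma1Fun, sub_sub_cancel]
      exact jmuSystem_coeff_sigma1 hx0 hx1 hk0 l'.2.1 l'.2.2.1 l'.2.2.2
    · intro t0 tx t1 ht1 htx ht0 g0 gx g1 e0 ex e1
      have hΨ' := (hiff Ψ b).mp hΨ
      have haff := isAffineChange_sigma1Map x
      have hhf : ∀ l : PuncturedPlane x, 1 - (sigma1Map x l : ℂ) = l := haff.inverse_apply
      have n1 := hM0.map hinv hcoeff hhf
      have nx := hMx.map hinv hcoeff hhf
      have n0 := hM1.map hinv hcoeff hhf
      rw [← ht0] at n0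
      rw [← ht1] at n1
      rw [← htx] at nx
      have n0' := n0.symm (hd1 ▸ one_ne_zero)
      have nx' := nx.symm (hdx ▸ one_ne_zero)
      have m0 := n0.of_homotopic hSt' e0.symm
      have mx := ((n0'.trans nx).trans n0).of_homotopic hSt' ex.symm
      have m1 := ((((n0'.trans nx').trans n1).trans nx).trans n0).of_homotopic hSt' e1.symm
      simp only [← mul_assoc] at mx m1
      have b1 := haff.isLoopAround hγ.around_zero
      have bx := haff.isLoopAround hγ.around_x
      have b0 := haff.isLoopAround hγ.around_one
      have ball := haff.isLoopAroundAll hγ.around_all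
      have bgen := haff.closure_eq_top hγ.generate
      rw [Path.map_trans, Path.map_trans] at ball
      rw [← ht0, ← ht1, ← htx] at ball bgen
      rw [← ht0, mul_one, neg_add_cancel] at b0
      rw [← ht1, mul_zero, zero_add] at b1
      rw [← htx, neg_one_mul, neg_add_eq_sub] at bx
      refine ⟨isOrderedBasis_of_conj_left b0 b1 bx ball bgen e0 ex e1, m0.iff_eq hΨ',
        mx.iff_eq hΨ', m1.iff_eq hΨ', fun N0 Nx N1 h0 hx h1 => ?_⟩
      rw [(m0.iff_eq hΨ' N0).mp h0, (mx.iff_eq hΨ' Nx).mp hx, (m1.iff_eq hΨ' N1).mp h1]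
      have u1 : M1⁻¹ * M1 = 1 := Matrix.nonsing_inv_mul M1 (hd1 ▸ isUnit_one)
      have ux : Mx⁻¹ * Mx = 1 := Matrix.nonsing_inv_mul Mx (hdx ▸ isUnit_one)
      refine ⟨?_, ?_, ?_⟩
      · rw [Matrix.trace_mul_comm]
        simp only [mul_assoc, u1, mul_one]
      -- Conjugation by M₁ and cyclicity reduce this to the trace computed for σ³.
      · have h2 : (M1 * (M1 * Mx * M0 * Mx⁻¹ * M1⁻¹)).trace = (M0 * (Mx⁻¹ * M1 * Mx)).trace := by
          rw [Matrix.trace_mul_comm]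
          simp only [mul_assoc, u1, mul_one]
          rw [← mul_assoc, Matrix.trace_mul_comm]
          simp only [mul_assoc]
        rw [h2, htrace]
        ring
      · rw [Matrix.trace_mul_comm]
        -- The product is a conjugate of Mₓ M₀ by M₁ Mₓ.
        have h2 : M1 * Mx * M1⁻¹ * (M1 * Mx * M0 * Mx⁻¹ * M1⁻¹)
            = (M1 * Mx) * (Mx * M0 * (M1 * Mx)⁻¹) := by
          rw [Matrix.mul_inv_rev]
          simp only [mul_assoc]
          rw [← mul_assoc M1⁻¹, u1, one_mul]
        have hdet : IsUnit (M1 * Mx).det := by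
          rw [Matrix.det_mul, hdx, hd1, one_mul]
          exact isUnit_one
        rw [h2, Matrix.trace_mul_comm, mul_assoc, Matrix.nonsing_inv_mul _ hdet, mul_one,
          Matrix.trace_mul_comm]
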